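/- **Setting.** Let $\Gamma=\bigcup_{\gamma\in\mathcal E}\gamma([0,1])\subset\mathbb R^N$ be an embedded network: $\mathcal E$ is a finite set of regular ($C^1$ with nonvanishing derivative) simple curves $\gamma:[0,1]\to\mathbb R^N$ (possibly closed, i.e. $\gamma(0)=\gamma(1)$; $\mathcal E^*$ denotes the set of closed ones), which contains with each $\gamma$ its inverse $\widetilde\gamma(s)=\gamma(1-s)$, such that $\gamma((0,1))\cap\gamma'((0,1))=\emptyset$ whenever $\gamma'\neq\gamma,\widetilde\gamma$. The set $\mathbf V$ of vertices consists of the endpoints of the arcs; no vertex lies in any $\gamma((0,1))$, and any two vertices are linked by a finite concatenation of arcs. Continuity of functions on $\Gamma$ refers to the geodesic distance of $\Gamma$. For each $\gamma\in\mathcal E$ let $H_\gamma:[0,1]\times\mathbb R\to\mathbb R$ be continuous, coercive and quasiconvex in $p$, with $\operatorname{Int}\{p: H_\gamma(s,p)\le b\}=\{p: H_\gamma(s,p)<b\}$ for all $s\in[0,1]$, $b\in\mathbb R$, and $H_{\widetilde\gamma}(s,p)=H_\gamma(1-s,-p)$. Put $a_\gamma=\max_s\min_pH_\gamma(s,p)$;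 let $c_\gamma$ be the least $b$ for which there is a continuous function $w$ on $[0,1]$ with $w(0)=w(1)$ that is a viscosity subsolution of $H_\gamma(s,w')=b$ in $(0,1)$; and let $a_0=\max\{\max_{\gamma\in\mathcal E\setminus\mathcal E^*}a_\gamma,\ \max_{\gamma\in\mathcal E^*}c_\gamma\}$. Assume that for every $\gamma$ with $a_\gamma=a_0$ the function $s\mapsto\min_pH_\gamma(s,p)$ is constant on $[0,1]$. For $a\ge a_0$ let $\sigma_a(\gamma)=\int_0^1\max\{p: H_\gamma(t,p)=a\}\,dt$, and let the critical value $c$ be the least $a\ge a_0$ for which there is $g:\mathbf V\to\mathbb R$ with $g(\gamma(0))\le g(\gamma(1))+\sigma_a(\widetilde\gamma)$ for all $\gamma\in\mathcal E$ (a subsolution of the discrete functional equation on the underlying graph). A *subsolution* of $\mathcal H(x,Du)=a$ is a continuous $u:\Gamma\to\mathbb R$ such that $u\circ\gamma$ is a viscosity subsolution of $H_\gamma(s,(u\circ\gamma)')=a$ in $(0,1)$ for every $\gamma\in\mathcal E$. A continuous $u:\Gamma\to\mathbb R$ is a *solution in* $\Gamma'\subset\Gamma$ if, whenever $\gamma(s_0)\in\Gamma'$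 with $\gamma\in\mathcal E$ and $s_0\in(0,1)$, $u\circ\gamma$ satisfies the viscosity sub- and supersolution conditions at $s_0$, and if for every vertex $x\in\Gamma'$ there is an arc $\gamma$ with $\gamma(1)=x$ for which the state constraint condition holds: $H_\gamma(1,\varphi'(1))\ge a$ for every $\varphi\in C^1([0,1])$ with $\varphi(1)=u(\gamma(1))$ and $\varphi\le u\circ\gamma$ in $(1-\delta,1)$ for some $\delta>0$. **Theorem.** Let $a\ge c$, $y\in\Gamma$ (a vertex or an interior point of an arc) and $\alpha\in\mathbb R$. Then there is a (pointwise) maximal subsolution $w$ of $\mathcal H(x,Du)=a$ on $\Gamma$ among those with value $\alpha$ at $y$, and $w$ is a solution in $\Gamma\setminus\{y\}$; in particular the state constraint condition holds at every vertex other than $y$. -/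

import Mathlib

open Set Filter Topology
open scoped ENNReal

noncomputable section

/-- An embedded network in `ℝ^N`: a finite collection of regular simple curves parametrized on
`[0,1]` (only the values of `arc e` on `[0,1]` matter), closed under reversal of orientation.
The index type `E` is the edge set of the underlying abstract graph. -/
structure EmbeddedNetwork (N : ℕ) (E : Type*) [Finite E] where
  /-- the arc with index `e` -/
  arc : E → ℝ → EuclideanSpace ℝ (Fin N)
  /-- the index of the inverse arc -/
  rev : E → E
  rev_rev : ∀ e, rev (rev e) = e
  arc_rev : ∀ e, ∀ s ∈ Icc (0 : ℝ) 1, arc (rev e) s = arc e (1 - s)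
  contDiffOn_arc : ∀ e, ContDiffOn ℝ 1 (arc e) (Icc 0 1)
  regular : ∀ e, ∀ s ∈ Icc (0 : ℝ) 1, derivWithin (arc e) (Icc 0 1) s ≠ 0
  /-- no self-intersections, except that the two endpoints may coincide -/
  simple : ∀ e, ∀ s ∈ Icc (0 : ℝ) 1, ∀ t ∈ Icc (0 : ℝ) 1, arc e s = arc e t →
    s = t ∨ (s = 0 ∧ t = 1) ∨ (s = 1 ∧ t = 0)
  disjoint_interiors : ∀ e e', e ≠ e' → e ≠ rev e' →
    Disjoint (arc e '' Ioo 0 1) (arc e' '' Ioo 0 1)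
  /-- no endpoint of an arc lies in the interior of an arc -/
  disjoint_vertices : ∀ e e', arc e 0 ∉ arc e' '' Ioo 0 1
  /-- any two vertices (each vertex is the initial point of some arc) are linked by a finite
  concatenation of arcs -/
  connected : ∀ e e', Relation.ReflTransGen (fun x z => ∃ f, arc f 0 = x ∧ arc f 1 = z)
    (arc e 0) (arc e' 0)

namespace EmbeddedNetwork

variable {N : ℕ} {E : Type*} [Finite E] (G : EmbeddedNetwork N E)

/-- The point set `Γ ⊆ ℝ^N` of the network. -/
def support : Set (EuclideanSpace ℝ (Fin N)) := ⋃ e, G.arc e '' Icc 0 1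

/-- The vertices: initial and terminal points of the arcs. -/
def vertices : Set (EuclideanSpace ℝ (Fin N)) := {x | ∃ e, x = G.arc e 0 ∨ x = G.arc e 1}

/-- The initial vertex `o(e)`. -/
def origin (e : E) : G.vertices := ⟨G.arc e 0, e, Or.inl rfl⟩

/-- The terminal vertex `t(e)`. -/
def terminus (e : E) : G.vertices := ⟨G.arc e 1, e, Or.inr rfl⟩

/-- The arc with index `e` is a closed curve. -/
def IsClosedArc (e : E) : Prop := G.arc e 0 = G.arc e 1

/-- The arc `γ_e`, as a map from `[0,1]` to `Γ`. -/
def arcMap (e : E) (s : Icc (0 : ℝ) 1) : G.support :=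
  ⟨G.arc e s, mem_iUnion.2 ⟨e, mem_image_of_mem _ s.2⟩⟩

/-- The function `u ∘ γ_e` on `[0,1]` (extended by constants to `ℝ`). -/
def pullback (u : G.support → ℝ) (e : E) : ℝ → ℝ :=
  IccExtend (zero_le_one' ℝ) (fun s => u (G.arcMap e s))

/-- The geodesic distance on `Γ` induced by the Euclidean metric: infimum of the lengths of the
continuous curves contained in `Γ` and joining the two points. -/
def geodesicDist (x z : G.support) : ℝ≥0∞ :=
  ⨅ (ξ : ℝ → EuclideanSpace ℝ (Fin N)) (_ : ContinuousOn ξ (Icc 0 1) ∧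
    MapsTo ξ (Icc 0 1) G.support ∧ ξ 0 = x ∧ ξ 1 = z), eVariationOn ξ (Icc 0 1)

/-- Continuity of a function on `Γ` with respect to the geodesic distance. -/
def IsContinuous (u : G.support → ℝ) : Prop :=
  ∀ x, ∀ ε : ℝ, 0 < ε → ∃ δ : ℝ≥0∞, 0 < δ ∧ ∀ z, G.geodesicDist x z < δ → |u z - u x| < ε

end EmbeddedNetwork

/-! ### Viscosity notions on `[0,1]` -/

/-- `φ ∈ C¹([0,1])` touches `w` from above at `s`, locally in `[0,1]`. -/
def IsSupertangentAt (w φ : ℝ → ℝ) (s : ℝ) : Prop :=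
  ContDiffOn ℝ 1 φ (Icc 0 1) ∧ φ s = w s ∧ ∀ᶠ t in 𝓝[Icc (0 : ℝ) 1] s, w t ≤ φ t

/-- `φ ∈ C¹([0,1])` touches `w` from below at `s`, locally in `[0,1]`. At `s ∈ {0,1}` the
comparison is one-sided, so this is the notion of constrained subtangent. -/
def IsSubtangentAt (w φ : ℝ → ℝ) (s : ℝ) : Prop :=
  ContDiffOn ℝ 1 φ (Icc 0 1) ∧ φ s = w s ∧ ∀ᶠ t in 𝓝[Icc (0 : ℝ) 1] s, φ t ≤ w t

/-- Viscosity subsolution test for `h(s, w') = a` at the point `s`. -/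
def ViscositySubAt (h : ℝ → ℝ → ℝ) (a : ℝ) (w : ℝ → ℝ) (s : ℝ) : Prop :=
  ∀ φ, IsSupertangentAt w φ s → h s (derivWithin φ (Icc 0 1) s) ≤ a

/-- Viscosity supersolution test for `h(s, w') = a` at the point `s`. For `s ∈ {0,1}` this is the
state constraint boundary condition. -/
def ViscositySuperAt (h : ℝ → ℝ → ℝ) (a : ℝ) (w : ℝ → ℝ) (s : ℝ) : Prop :=
  ∀ φ, IsSubtangentAt w φ s → a ≤ h s (derivWithin φ (Icc 0 1) s)

/-- A Hamiltonian on the network: a family of Hamiltonians `H_γ` on `[0,1] × ℝ`, compatible with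
reversal of the arcs, continuous, coercive and quasiconvex in `p`, with
`Int {H_γ(s,·) ≤ a} = {H_γ(s,·) < a}`. -/
structure NetworkHamiltonian {N : ℕ} {E : Type*} [Finite E] (G : EmbeddedNetwork N E) where
  /-- the Hamiltonian `H_γ(s,p)` on the arc with index `e` -/
  ham : E → ℝ → ℝ → ℝ
  ham_rev : ∀ e, ∀ s ∈ Icc (0 : ℝ) 1, ∀ p, ham (G.rev e) s p = ham e (1 - s) (-p)
  continuousOn_ham : ∀ e,
    ContinuousOn (fun q : ℝ × ℝ => ham e q.1 q.2) (Icc (0 : ℝ) 1 ×ˢ univ)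
  coercive : ∀ e, ∀ s ∈ Icc (0 : ℝ) 1, Tendsto (ham e s) (cocompact ℝ) atTop
  quasiconvex : ∀ e, ∀ s ∈ Icc (0 : ℝ) 1, QuasiconvexOn ℝ univ (ham e s)
  interior_sublevel : ∀ e, ∀ s ∈ Icc (0 : ℝ) 1, ∀ a,
    interior {p | ham e s p ≤ a} = {p | ham e s p < a}

namespace NetworkHamiltonian

variable {N : ℕ} {E : Type*} [Finite E] {G : EmbeddedNetwork N E} (H : NetworkHamiltonian G)

/-- `a_γ = max_s min_p H_γ(s,p)`. -/
def arcValue (e : E) : ℝ := ⨆ s : Icc (0 : ℝ) 1, ⨅ p : ℝ, H.ham e s p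

/-- `w` is a periodic subsolution of `H_γ = a`: a continuous function on `[0,1]` with equal values
at the endpoints, which is a viscosity subsolution in `(0,1)`. -/
def IsPeriodicSubsolution (e : E) (a : ℝ) (w : ℝ → ℝ) : Prop :=
  ContinuousOn w (Icc 0 1) ∧ w 0 = w 1 ∧ ∀ s ∈ Ioo (0 : ℝ) 1, ViscositySubAt (H.ham e) a w s

/-- `c_γ`, the least `a` such that `H_γ = a` has periodic subsolutions. -/
def periodicValue (e : E) : ℝ := sInf {a | ∃ w, H.IsPeriodicSubsolution e a w}

open Classical in
/-- `a₀`, the maximum of the `a_γ` over the non-closed arcs and the `c_γ` over the closed arcs. -/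
def baseValue : ℝ := ⨆ e, if G.IsClosedArc e then H.periodicValue e else H.arcValue e

/-- If `a_γ = a₀`, then `s ↦ min_p H_γ(s,p)` is constant on `[0,1]`. -/
def MinConstantAtBase : Prop :=
  ∀ e, H.arcValue e = H.baseValue →
    ∀ s ∈ Icc (0 : ℝ) 1, ∀ t ∈ Icc (0 : ℝ) 1, ⨅ p : ℝ, H.ham e s p = ⨅ p : ℝ, H.ham e t p

/-- `σ_a⁺(s) = max {p | H_γ(s,p) = a}`. -/
def sigmaPlus (e : E) (a s : ℝ) : ℝ := sSup {p | H.ham e s p = a}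

/-- `σ_a(e) = ∫₀¹ σ_a⁺(t) dt`. -/
def sigma (a : ℝ) (e : E) : ℝ := ∫ t in (0 : ℝ)..1, H.sigmaPlus e a t

/-- Subsolutions of the discrete functional equation `u(x) = min_{o(e) = x} (u(t(e)) + σ_a(-e))`
on the underlying abstract graph. -/
def IsDiscreteSubsolution (a : ℝ) (u : G.vertices → ℝ) : Prop :=
  ∀ x, ∀ e, G.origin e = x → u x ≤ u (G.terminus e) + H.sigma a (G.rev e)

/-- The Mañé critical value `c`, the least `a ≥ a₀` for which the discrete functional equation
has subsolutions. -/
def criticalValue : ℝ := sInf {a | H.baseValue ≤ a ∧ ∃ u, H.IsDiscreteSubsolution a u}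

/-- Subsolutions of `H(x,Du) = a` on `Γ`. -/
def IsSubsolution (a : ℝ) (u : G.support → ℝ) : Prop :=
  G.IsContinuous u ∧ ∀ e, ∀ s ∈ Ioo (0 : ℝ) 1, ViscositySubAt (H.ham e) a (G.pullback u e) s

/-- Solutions of `H(x,Du) = a` in a subset `Γ'` of `Γ`: `u` is continuous on `Γ`, the viscosity
solution condition holds at all interior points of arcs which are in `Γ'`, and for each vertex in
`Γ'` the state constraint boundary condition holds at `s = 1` for some arc ending there. -/
def IsSolutionOn (a : ℝ) (Γ' : Set G.support) (u : G.support → ℝ) : Prop :=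
  G.IsContinuous u ∧
  (∀ e, ∀ s : Icc (0 : ℝ) 1, (s : ℝ) ∈ Ioo (0 : ℝ) 1 → G.arcMap e s ∈ Γ' →
    ViscositySubAt (H.ham e) a (G.pullback u e) s ∧
    ViscositySuperAt (H.ham e) a (G.pullback u e) s) ∧
  (∀ x ∈ Γ', (x : EuclideanSpace ℝ (Fin N)) ∈ G.vertices →
    ∃ e, G.arc e 1 = x ∧ ViscositySuperAt (H.ham e) a (G.pullback u e) 1)

end NetworkHamiltonian

end

/-! The viscosity problem is turned into one about increments. By quasiconvexity and continuity the
sublevel of `H_γ(s,·)` at an admissible level is a compact interval, with top `σ_a⁺(s)` and, by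
reversal, bottom minus the top for the inverse arc. Hence `u` is a subsolution exactly when its
increments along every arc, inverse arcs included, are at most those of `F_γ = ∫ σ_a⁺`
(`isSubsolution_iff_dominated`). Such functions are called dominated.

Domination passes to pointwise suprema, and connectedness bounds all dominated functions with a
given value at `y`. So a maximal one, `w`, exists as soon as there is any dominated function
(`exists_isGreatest_dominated`).

Maximality makes `w` a solution away from `y`. If no arc into a point `x ≠ y` saturates the
increment bound at `x`, then `w` can be raised by a small `η` at `x`, with the increase cut off by
descending backwards along those arcs at full rate `F`. This gives a larger competitor with the same
value at `y`, which is impossible (`exists_carried_of_vertex`, `carried_of_interior`). If some arc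
does saturate the bound from `r` to `s`, then `w` grows there exactly like `F`. Subtangents at `s`
then have slope at least `σ_a⁺(s)`, where `H_γ ≥ a`. Only the left side of `s` is used, so at `s =
1` this is the state constraint condition (`viscositySuperAt_of_carried`).

A dominated function exists for every `a ≥ c`: above `c` it extends a discrete subsolution, and at
`c` it is a limit from above (`exists_dominated`). -/

namespace NetworkHamiltonian

variable {N : ℕ} {E : Type*} [Finite E] {G : EmbeddedNetwork N E} (H : NetworkHamiltonian G)

/-! ### Sublevel intervals, their top `σ_a⁺`, and its primitive -/

/-- The level `a` is attained above every point of every arc: all sublevels `{H_γ(s,·) ≤ a}` are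
nonempty. -/
def Admissible (a : ℝ) : Prop := ∀ e, ∀ s ∈ Icc (0 : ℝ) 1, ∃ p, H.ham e s p ≤ a

variable {H} {e : E} {s a : ℝ}

theorem Admissible.mono {b : ℝ} (h : H.Admissible a) (hab : a ≤ b) : H.Admissible b :=
  fun e s hs => (h e s hs).imp fun _ hp => hp.trans hab

theorem continuous_ham (hs : s ∈ Icc (0 : ℝ) 1) : Continuous (H.ham e s) :=
  (H.continuousOn_ham e).comp_continuous (f := fun p : ℝ => (s, p)) (by fun_prop)
    fun p => ⟨hs, mem_univ p⟩

theorem continuousOn_ham_left (p : ℝ) : ContinuousOn (fun s => H.ham e s p) (Icc 0 1) :=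
  (H.continuousOn_ham e).comp (f := fun s : ℝ => (s, p)) (by fun_prop) fun _ ht => ⟨ht, mem_univ p⟩

theorem ham_le_max (hs : s ∈ Icc (0 : ℝ) 1) {p q r : ℝ} (hpq : p ≤ q) (hqr : q ≤ r) :
    H.ham e s q ≤ max (H.ham e s p) (H.ham e s r) :=
  (((H.quasiconvex e s hs) (max (H.ham e s p) (H.ham e s r))).ordConnected.out
    ⟨mem_univ _, le_max_left _ _⟩ ⟨mem_univ _, le_max_right _ _⟩ ⟨hpq, hqr⟩).2

theorem isCompact_sublevel (hs : s ∈ Icc (0 : ℝ) 1) (a : ℝ) : IsCompact {p | H.ham e s p ≤ a} := by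
  have h := (H.coercive e s hs).eventually (eventually_gt_atTop a)
  obtain ⟨K, hK, hKs⟩ := mem_cocompact.1 h
  refine hK.of_isClosed_subset (isClosed_le (continuous_ham hs) continuous_const) fun p hp => ?_
  by_contra hpK
  exact absurd (show a < H.ham e s p from hKs hpK) (not_lt.2 hp)

/-- `σ_a⁺(s)` is the greatest element of the sublevel `{H_γ(s,·) ≤ a}`. -/
theorem isGreatest_sigmaPlus (hs : s ∈ Icc (0 : ℝ) 1) (ha : ∃ p, H.ham e s p ≤ a) :
    H.ham e s (H.sigmaPlus e a s) = a ∧ ∀ p, H.ham e s p ≤ a → p ≤ H.sigmaPlus e a s := by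
  obtain ⟨m, hm, hmax⟩ := (isCompact_sublevel (H := H) (e := e) hs a).exists_isGreatest ha
  have hm' : H.ham e s m = a := by
    -- Strictly below level `a`, the maximal point `m` would be interior to the sublevel, so larger
    -- elements would exist.
    refine le_antisymm hm (not_lt.1 fun hlt => ?_)
    have : m ∈ interior {p | H.ham e s p ≤ a} := by
      rw [H.interior_sublevel e s hs]; exact hlt
    obtain ⟨p, hp, hmp⟩ := ((eventually_nhdsWithin_of_eventually_nhds
      (mem_interior_iff_mem_nhds.1 this)).and (self_mem_nhdsWithin (s := Ioi m))).exists
    exact absurd (hmax hp) (not_le.2 hmp)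
  have : IsGreatest {p | H.ham e s p = a} m := ⟨hm', fun p hp => hmax (le_of_eq hp)⟩
  rw [sigmaPlus, this.csSup_eq]
  exact ⟨hm', fun p hp => hmax hp⟩

theorem le_ham_of_sigmaPlus_le (hs : s ∈ Icc (0 : ℝ) 1) (ha : ∃ p, H.ham e s p ≤ a) {p : ℝ}
    (hp : H.sigmaPlus e a s ≤ p) : a ≤ H.ham e s p := by
  by_contra! hlt
  have := le_antisymm ((isGreatest_sigmaPlus hs ha).2 p hlt.le) hp
  rw [this, (isGreatest_sigmaPlus hs ha).1] at hlt
  exact lt_irrefl _ hlt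

theorem lt_ham_of_sigmaPlus_lt (hs : s ∈ Icc (0 : ℝ) 1) (ha : ∃ p, H.ham e s p ≤ a) {p : ℝ}
    (hp : H.sigmaPlus e a s < p) : a < H.ham e s p :=
  not_le.1 fun h => absurd ((isGreatest_sigmaPlus hs ha).2 p h) (not_le.2 hp)

theorem sigmaPlus_mono (hs : s ∈ Icc (0 : ℝ) 1) (ha : ∃ p, H.ham e s p ≤ a) {b : ℝ} (hab : a ≤ b) :
    H.sigmaPlus e a s ≤ H.sigmaPlus e b s :=
  (isGreatest_sigmaPlus hs (ha.imp fun _ h => h.trans hab)).2 _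
    ((isGreatest_sigmaPlus hs ha).1.trans_le hab)

/-- Since `H_γ̃(s,p) = H_γ(1-s,-p)`, the top of the sublevel for the inverse arc becomes, up to
sign, the bottom for the arc itself. -/
theorem ham_neg_sigmaPlus_rev (ha : H.Admissible a) (hs : s ∈ Icc (0 : ℝ) 1) :
    H.ham e s (-H.sigmaPlus (G.rev e) a (1 - s)) = a := by
  have hs' : 1 - s ∈ Icc (0 : ℝ) 1 := ⟨by linarith [hs.2], by linarith [hs.1]⟩
  have h := (isGreatest_sigmaPlus hs' (ha (G.rev e) _ hs')).1
  rwa [H.ham_rev e _ hs', sub_sub_cancel] at h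

theorem neg_sigmaPlus_rev_le (ha : H.Admissible a) (hs : s ∈ Icc (0 : ℝ) 1) :
    -H.sigmaPlus (G.rev e) a (1 - s) ≤ H.sigmaPlus e a s :=
  (isGreatest_sigmaPlus hs (ha e s hs)).2 _ (ham_neg_sigmaPlus_rev ha hs).le

theorem continuousOn_sigmaPlus (ha : H.Admissible a) :
    ContinuousOn (H.sigmaPlus e a) (Icc 0 1) := by
  intro s₀ hs₀
  obtain ⟨hP, hPmax⟩ := isGreatest_sigmaPlus hs₀ (ha e s₀ hs₀)
  set P := H.sigmaPlus e a s₀ with hPdef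
  have hev : ∀ᶠ s in 𝓝[Icc 0 1] s₀, s ∈ Icc (0 : ℝ) 1 := self_mem_nhdsWithin
  have hlt : ∀ p b, H.ham e s₀ p < b → ∀ᶠ s in 𝓝[Icc 0 1] s₀, H.ham e s p < b := fun p b h =>
    (continuousOn_ham_left p s₀ hs₀).eventually (eventually_lt_nhds h)
  have hgt : ∀ p b, b < H.ham e s₀ p → ∀ᶠ s in 𝓝[Icc 0 1] s₀, b < H.ham e s p := fun p b h =>
    (continuousOn_ham_left p s₀ hs₀).eventually (eventually_gt_nhds h)
  refine tendsto_order.2 ⟨fun q hq => ?_, fun q hq => ?_⟩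
  -- Lower semicontinuity. If the level `a` is above the minimum, points just left of `P` lie
  -- strictly below level `a`, and this persists for nearby `s`.
  · by_cases hc : ∃ r, H.ham e s₀ r < a
    · obtain ⟨r, hr⟩ := hc
      have hrP : r < P := lt_of_le_of_ne (hPmax r hr.le) (by rintro rfl; exact hr.ne hP)
      have hint : Ioo r P ⊆ {p | H.ham e s₀ p < a} := by
        rw [← H.interior_sublevel e s₀ hs₀]
        refine interior_maximal (fun p hp => ?_) isOpen_Ioo
        have := ham_le_max (H := H) (e := e) hs₀ hp.1.le hp.2.le
        rw [hP, max_eq_right hr.le] at this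
        exact this
      obtain ⟨p, hp1, hp2⟩ := exists_between (max_lt hrP hq)
      filter_upwards [hlt p a (hint ⟨(le_max_left _ _).trans_lt hp1, hp2⟩), hev] with s h hs
      exact ((le_max_right _ _).trans_lt hp1).trans_le
        ((isGreatest_sigmaPlus hs (ha e s hs)).2 p h.le)
    -- If `a` is the minimum, the sublevel has empty interior and so reduces to `P`. Then `q` is
    -- strictly above level `a`, and a top at or left of `q` for nearby `s` would violate
    -- quasiconvexity between that top and `P`.
    · have hc : ∀ r, a ≤ H.ham e s₀ r := by simpa using hc
      have hqa : a < H.ham e s₀ q := by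
        refine lt_of_le_of_ne (hc q) fun hqe => ?_
        have hint : Ioo q P ⊆ {p | H.ham e s₀ p < a} := by
          rw [← H.interior_sublevel e s₀ hs₀]
          refine interior_maximal (fun p hp => ?_) isOpen_Ioo
          have := ham_le_max (H := H) (e := e) hs₀ hp.1.le hp.2.le
          rw [hP, ← hqe, max_self] at this
          exact this
        obtain ⟨p, hp⟩ := nonempty_Ioo.2 hq
        exact absurd (hint hp) (not_lt.2 (hc p))
      obtain ⟨b, hab, hbq⟩ := exists_between hqa
      filter_upwards [hlt P b (hP.trans_lt hab), hgt q b hbq, hev] with s h1 h2 hs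
      by_contra! hle
      have := ham_le_max (H := H) (e := e) hs hle hq.le
      rw [(isGreatest_sigmaPlus hs (ha e s hs)).1] at this
      exact absurd (this.trans_lt (max_lt hab h1)) (not_lt.2 h2.le)
  · obtain ⟨b, hab, hbq⟩ := exists_between (lt_ham_of_sigmaPlus_lt hs₀ (ha e s₀ hs₀) hq)
    filter_upwards [hlt P b (hP.trans_lt hab), hgt q b hbq, hev] with s h1 h2 hs
    by_contra! hle
    have := ham_le_max (H := H) (e := e) hs hq.le hle
    rw [(isGreatest_sigmaPlus hs (ha e s hs)).1] at this
    exact absurd (this.trans_lt (max_lt h1 hab)) (not_lt.2 h2.le)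

variable (H e a) in
/-- The continuous extension of `σ_a⁺` to the line by constants. -/
noncomputable def sigmaExt (t : ℝ) : ℝ := H.sigmaPlus e a (projIcc 0 1 zero_le_one t)

variable (H e a) in
/-- The primitive `t ↦ ∫₀ᵗ σ_a⁺`. -/
noncomputable def sigmaPrim (t : ℝ) : ℝ := ∫ r in (0 : ℝ)..t, H.sigmaExt e a r

theorem sigmaExt_of_mem (hs : s ∈ Icc (0 : ℝ) 1) : H.sigmaExt e a s = H.sigmaPlus e a s := by
  rw [sigmaExt, projIcc_of_mem _ hs]

theorem continuous_sigmaExt (ha : H.Admissible a) : Continuous (H.sigmaExt e a) :=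
  (continuousOn_sigmaPlus ha).comp_continuous (by fun_prop) fun t => (projIcc 0 1 zero_le_one t).2

theorem hasDerivAt_sigmaPrim (ha : H.Admissible a) (t : ℝ) :
    HasDerivAt (H.sigmaPrim e a) (H.sigmaExt e a t) t :=
  ((continuous_sigmaExt ha).integral_hasStrictDerivAt 0 t).hasDerivAt

theorem contDiff_sigmaPrim (ha : H.Admissible a) : ContDiff ℝ 1 (H.sigmaPrim e a) := by
  refine contDiff_one_iff_deriv.2 ⟨fun t => (hasDerivAt_sigmaPrim ha t).differentiableAt, ?_⟩
  rw [funext fun t => (hasDerivAt_sigmaPrim (e := e) ha t).deriv]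
  exact continuous_sigmaExt ha

theorem sigmaPrim_zero : H.sigmaPrim e a 0 = 0 := intervalIntegral.integral_same

theorem sigmaPrim_one : H.sigmaPrim e a 1 = H.sigma a e := by
  refine intervalIntegral.integral_congr fun t ht => ?_
  rw [uIcc_of_le zero_le_one] at ht
  exact sigmaExt_of_mem ht

/-- The derivative of `F_γ(t) - F_γ̃(1-t)` is the length of the sublevel interval at `t`, hence
nonnegative. -/
theorem sigmaPrim_reversible (ha : H.Admissible a) (e : E) {s t : ℝ} (hs : 0 ≤ s) (hst : s ≤ t)
    (ht : t ≤ 1) : 0 ≤ H.sigmaPrim (G.rev e) a (1 - s) - H.sigmaPrim (G.rev e) a (1 - t) +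
      (H.sigmaPrim e a t - H.sigmaPrim e a s) := by
  have hd : ∀ t, HasDerivAt (fun t => H.sigmaPrim e a t - H.sigmaPrim (G.rev e) a (1 - t))
      (H.sigmaExt e a t - -H.sigmaExt (G.rev e) a (1 - t)) t := fun t => by
    exact (hasDerivAt_sigmaPrim ha t).fun_sub
      (hasDerivAt_sigmaPrim ha (1 - t)).comp_const_sub
  have hmono : MonotoneOn (fun t => H.sigmaPrim e a t - H.sigmaPrim (G.rev e) a (1 - t))
      (Icc 0 1) := by
    refine monotoneOn_of_deriv_nonneg (convex_Icc 0 1)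
      (fun t _ => (hd t).continuousAt.continuousWithinAt)
      (fun t _ => (hd t).differentiableAt.differentiableWithinAt) fun t ht => ?_
    have ht' := interior_subset ht
    have ht'' : 1 - t ∈ Icc (0 : ℝ) 1 := ⟨by linarith [ht'.2], by linarith [ht'.1]⟩
    rw [(hd t).deriv, sigmaExt_of_mem ht', sigmaExt_of_mem ht'']
    linarith [neg_sigmaPlus_rev_le (e := e) ha ht']
  have := hmono ⟨hs, hst.trans ht⟩ ⟨hs.trans hst, ht⟩ hst
  simp only at this
  linarith

end NetworkHamiltonian

/-! ### Dominated functions on the network and maximality -/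

namespace EmbeddedNetwork

variable {N : ℕ} {E : Type*} [Finite E] {G : EmbeddedNetwork N E}

theorem one_sub_mem {s : ℝ} (hs : s ∈ Icc (0 : ℝ) 1) : 1 - s ∈ Icc (0 : ℝ) 1 :=
  ⟨by linarith [hs.2], by linarith [hs.1]⟩

theorem arc_rev_zero (e : E) : G.arc (G.rev e) 0 = G.arc e 1 := by
  rw [G.arc_rev e 0 (by simp), sub_zero]

theorem arc_rev_one (e : E) : G.arc (G.rev e) 1 = G.arc e 0 := by
  rw [G.arc_rev e 1 (by simp), sub_self]

theorem pullback_of_mem (u : G.support → ℝ) (e : E) {s : ℝ} (hs : s ∈ Icc (0 : ℝ) 1) :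
    G.pullback u e s = u (G.arcMap e ⟨s, hs⟩) := by
  rw [pullback, IccExtend_of_mem _ _ hs]

theorem pullback_eq (u : G.support → ℝ) {e : E} {s : ℝ} (hs : s ∈ Icc (0 : ℝ) 1) {x : G.support}
    (h : G.arc e s = x) : G.pullback u e s = u x := by
  rw [pullback_of_mem u e hs]; exact congrArg u (Subtype.ext h)

theorem pullback_rev (u : G.support → ℝ) (e : E) {s : ℝ} (hs : s ∈ Icc (0 : ℝ) 1) :
    G.pullback u (G.rev e) s = G.pullback u e (1 - s) := by
  rw [pullback_of_mem u e (one_sub_mem hs)]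
  exact pullback_eq u hs (G.arc_rev e s hs)

theorem exists_arc_eq (x : G.support) : ∃ e, ∃ s ∈ Icc (0 : ℝ) 1, G.arc e s = x := by
  obtain ⟨e, s, hs, h⟩ := mem_iUnion.1 x.2
  exact ⟨e, s, hs, h⟩

theorem arc_one_notMem (e e' : E) : G.arc e 1 ∉ G.arc e' '' Ioo 0 1 := by
  rw [← arc_rev_zero]; exact G.disjoint_vertices _ _

theorem eq_zero_or_one_of_mem_vertices {e : E} {s : ℝ} (hs : s ∈ Icc (0 : ℝ) 1)
    (h : G.arc e s ∈ G.vertices) : s = 0 ∨ s = 1 := by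
  by_contra! hne
  have hs' : s ∈ Ioo (0 : ℝ) 1 := ⟨hs.1.lt_of_ne' hne.1, hs.2.lt_of_ne hne.2⟩
  obtain ⟨f, hf | hf⟩ := h
  · exact G.disjoint_vertices f e ⟨s, hs', hf⟩
  · exact arc_one_notMem f e ⟨s, hs', hf⟩

theorem exists_arc_one_eq {x : EuclideanSpace ℝ (Fin N)} (hx : x ∈ G.vertices) :
    ∃ e, G.arc e 1 = x := by
  obtain ⟨e, rfl | rfl⟩ := hx
  · exact ⟨G.rev e, arc_rev_one e⟩
  · exact ⟨e, rfl⟩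

/-- A family of functions on the arcs, compatible with reversal and with prescribed values at the
vertices, comes from a function on the network. -/
theorem exists_pullback_eq (f : E → ℝ → ℝ) (g : EuclideanSpace ℝ (Fin N) → ℝ)
    (hrev : ∀ e, ∀ t ∈ Icc (0 : ℝ) 1, f (G.rev e) t = f e (1 - t))
    (hg : ∀ e, f e 1 = g (G.arc e 1)) :
    ∃ u : G.support → ℝ, ∀ e, ∀ t ∈ Icc (0 : ℝ) 1, G.pullback u e t = f e t := by
  have hg0 : ∀ e, f e 0 = g (G.arc e 0) := fun e => by
    rw [← arc_rev_one, ← hg, hrev e 1 (by simp), sub_self]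
  have hgv : ∀ e, ∀ t ∈ Icc (0 : ℝ) 1, G.arc e t ∈ G.vertices → f e t = g (G.arc e t) := by
    intro e t ht h
    obtain rfl | rfl := eq_zero_or_one_of_mem_vertices ht h
    exacts [hg0 e, hg e]
  -- Independence of the representation of a point: vertices are handled by `g`, while an interior
  -- point has only one parameter up to reversal.
  have key : ∀ e e', ∀ s ∈ Icc (0 : ℝ) 1, ∀ t ∈ Icc (0 : ℝ) 1, G.arc e s = G.arc e' t →
      f e s = f e' t := by
    intro e e' s hs t ht h
    by_cases hv : G.arc e s ∈ G.vertices
    · rw [hgv e s hs hv, hgv e' t ht (h ▸ hv), h]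
    have mem : ∀ e, ∀ s ∈ Icc (0 : ℝ) 1, G.arc e s ∉ G.vertices → s ∈ Ioo (0 : ℝ) 1 := by
      refine fun e s hs hv => ⟨hs.1.lt_of_ne' ?_, hs.2.lt_of_ne ?_⟩
      · rintro rfl; exact hv ⟨e, Or.inl rfl⟩
      · rintro rfl; exact hv ⟨e, Or.inr rfl⟩
    have hs' := mem e s hs hv
    have ht' := mem e' t ht (h ▸ hv)
    have inj : ∀ e, ∀ s ∈ Ioo (0 : ℝ) 1, ∀ t ∈ Ioo (0 : ℝ) 1, G.arc e s = G.arc e t → s = t := by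
      intro e s hs t ht h
      rcases G.simple e s (Ioo_subset_Icc_self hs) t (Ioo_subset_Icc_self ht) h with
        h | ⟨h, -⟩ | ⟨h, -⟩
      · exact h
      · exact absurd h hs.1.ne'
      · exact absurd h hs.2.ne
    by_cases h1 : e = e'
    · subst h1; rw [inj e s hs' t ht' h]
    by_cases h2 : e = G.rev e'
    · subst h2
      rw [G.arc_rev e' s hs] at h
      rw [hrev e' s hs, inj e' _ ⟨by linarith [hs'.2], by linarith [hs'.1]⟩ t ht' h]
    · exact absurd (mem_image_of_mem _ ht')
        (disjoint_left.1 (G.disjoint_interiors e e' h1 h2) (h ▸ mem_image_of_mem _ hs'))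
  choose ε σ hσ hεσ using exists_arc_eq (G := G)
  refine ⟨fun x => f (ε x) (σ x), fun e t ht => ?_⟩
  rw [pullback_of_mem _ _ ht]
  exact key _ _ _ (hσ _) _ ht (hεσ _)

variable (G) in
/-- The increments of `u` along each arc are bounded by those of `F`. -/
def Dominated (F : E → ℝ → ℝ) (u : G.support → ℝ) : Prop :=
  ∀ e s t, 0 ≤ s → s ≤ t → t ≤ 1 → G.pullback u e t - G.pullback u e s ≤ F e t - F e s

variable (G) in
/-- Traversing a piece of an arc forth and back has nonnegative cost. -/
def Reversible (F : E → ℝ → ℝ) : Prop :=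
  ∀ e s t, 0 ≤ s → s ≤ t → t ≤ 1 →
    0 ≤ F (G.rev e) (1 - s) - F (G.rev e) (1 - t) + (F e t - F e s)

variable {F : E → ℝ → ℝ}

theorem Dominated.rev {u : G.support → ℝ} (h : G.Dominated F u) (e : E) {s t : ℝ} (hs : 0 ≤ s)
    (hst : s ≤ t) (ht : t ≤ 1) :
    G.pullback u e s - G.pullback u e t ≤ F (G.rev e) (1 - s) - F (G.rev e) (1 - t) := by
  have := h (G.rev e) (1 - t) (1 - s) (by linarith) (by linarith) (by linarith)
  rwa [pullback_rev _ _ ⟨by linarith, by linarith⟩, pullback_rev _ _ ⟨by linarith, by linarith⟩,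
    sub_sub_cancel, sub_sub_cancel] at this

/-- The value of a dominated function at a point bounds its value at any other point. -/
theorem exists_bound (F : E → ℝ → ℝ) (x z : G.support) :
    ∃ C, ∀ u, G.Dominated F u → u z ≤ u x + C := by
  have fwd : ∀ e, ∀ s ∈ Icc (0 : ℝ) 1, ∀ t ∈ Icc (0 : ℝ) 1, ∃ C, ∀ u, G.Dominated F u →
      G.pullback u e t ≤ G.pullback u e s + C := by
    intro e s hs t ht
    rcases le_total s t with h | h
    · exact ⟨F e t - F e s, fun u hu => by linarith [hu e s t hs.1 h ht.2]⟩
    · exact ⟨_, fun u hu => sub_le_iff_le_add'.1 (hu.rev e ht.1 h hs.2)⟩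
  obtain ⟨e, s, hs, hx⟩ := exists_arc_eq x
  obtain ⟨f, t, ht, hz⟩ := exists_arc_eq z
  have h0 : (0 : ℝ) ∈ Icc (0 : ℝ) 1 := by simp
  have h1 : (1 : ℝ) ∈ Icc (0 : ℝ) 1 := by simp
  -- Constants add up along a chain of arcs; they are chosen before `u`, so the bound is uniform
  -- over dominated functions.
  have mid : ∀ q, Relation.ReflTransGen (fun x z => ∃ f, G.arc f 0 = x ∧ G.arc f 1 = z)
      (G.arc e 0) q → ∀ q' : G.support, (q' : EuclideanSpace ℝ (Fin N)) = q →
      ∃ C, ∀ u, G.Dominated F u → u q' ≤ G.pullback u e 0 + C := by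
    intro q hq
    induction hq with
    | refl => exact fun q' hq' => ⟨0, fun u _ => by rw [pullback_eq u h0 hq'.symm, add_zero]⟩
    | tail _ hstep ih =>
      obtain ⟨k, hk0, hk1⟩ := hstep
      intro q' hq'
      obtain ⟨C, hC⟩ := ih (G.arcMap k ⟨0, h0⟩) hk0
      obtain ⟨C', hC'⟩ := fwd k 0 h0 1 h1
      refine ⟨C + C', fun u hu => ?_⟩
      have := hC' u hu
      rw [pullback_eq u h1 (hk1.trans hq'.symm), pullback_of_mem u k h0] at this
      linarith [hC u hu]
  obtain ⟨C, hC⟩ := fwd e s hs 0 h0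
  obtain ⟨C', hC'⟩ := mid _ (G.connected e f) (G.arcMap f ⟨0, h0⟩) rfl
  obtain ⟨C'', hC''⟩ := fwd f 0 h0 t ht
  refine ⟨C + C' + C'', fun u hu => ?_⟩
  have h1 := hC u hu
  have h2 := hC' u hu
  have h3 := hC'' u hu
  rw [pullback_eq u hs hx] at h1
  rw [pullback_eq u ht hz, pullback_of_mem u f h0] at h3
  linarith

theorem Dominated.add_const {u : G.support → ℝ} (h : G.Dominated F u) (c : ℝ) :
    G.Dominated F (fun x => u x + c) := by
  intro e s t hs hst ht
  have := h e s t hs hst ht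
  rw [pullback_of_mem _ _ ⟨hs, hst.trans ht⟩, pullback_of_mem _ _ ⟨hs.trans hst, ht⟩] at this ⊢
  simpa using this

/-- There is a maximal dominated function with prescribed value at a point. -/
theorem exists_isGreatest_dominated {u₀ : G.support → ℝ} (hu₀ : G.Dominated F u₀) (y : G.support)
    (α : ℝ) : ∃ w, IsGreatest {u | G.Dominated F u ∧ u y = α} w := by
  set S := {u | G.Dominated F u ∧ u y = α} with hS
  have hne : (S : Set (G.support → ℝ)).Nonempty :=
    ⟨fun x => u₀ x + (α - u₀ y), hu₀.add_const _, by simp⟩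
  have : Nonempty S := hne.to_subtype
  have hbdd : ∀ x, BddAbove (range fun u : S => (u : G.support → ℝ) x) := fun x => by
    obtain ⟨C, hC⟩ := exists_bound F y x
    refine ⟨α + C, ?_⟩
    rintro _ ⟨u, rfl⟩
    exact (hC u u.2.1).trans_eq (by rw [u.2.2])
  have hle : ∀ u ∈ S, ∀ x, u x ≤ ⨆ u : S, (u : G.support → ℝ) x := fun u hu x =>
    le_ciSup (hbdd x) ⟨u, hu⟩
  refine ⟨fun x => ⨆ u : S, (u : G.support → ℝ) x, ⟨?_, ?_⟩, fun u hu x => hle u hu x⟩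
  · intro e s t hs hst ht
    rw [pullback_of_mem _ _ ⟨hs, hst.trans ht⟩, pullback_of_mem _ _ ⟨hs.trans hst, ht⟩,
      sub_le_iff_le_add]
    refine ciSup_le fun u => ?_
    have := u.2.1 e s t hs hst ht
    rw [pullback_of_mem _ _ ⟨hs, hst.trans ht⟩, pullback_of_mem _ _ ⟨hs.trans hst, ht⟩] at this
    linarith [hle u u.2 (G.arcMap e ⟨s, hs, hst.trans ht⟩)]
  · exact (iSup_congr fun u : S => u.2.2).trans (ciSup_const (ι := S))

/-- A maximal dominated function cannot be raised along the arcs. -/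
theorem le_of_isGreatest {y : G.support} {α : ℝ} {w : G.support → ℝ}
    (hw : IsGreatest {u | G.Dominated F u ∧ u y = α} w) (T : E → ℝ → ℝ)
    (g : EuclideanSpace ℝ (Fin N) → ℝ)
    (hT : ∀ e s t, 0 ≤ s → s ≤ t → t ≤ 1 → T e t - T e s ≤ F e t - F e s ∧
      T e s - T e t ≤ F (G.rev e) (1 - s) - F (G.rev e) (1 - t))
    (hg : ∀ e, max (G.pullback w e 1) (max (T e 1) (T (G.rev e) 0)) = g (G.arc e 1))
    (hy : ∀ e, ∀ s ∈ Icc (0 : ℝ) 1, G.arc e s = y → T e s ≤ G.pullback w e s) :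
    ∀ e, ∀ s ∈ Icc (0 : ℝ) 1, T e s ≤ G.pullback w e s := by
  -- The competitor is the maximum of `w`, `T` and the reversal of `T`. Including the reversal makes
  -- the family compatible with orientation even if `T` is not.
  obtain ⟨u, hu⟩ := exists_pullback_eq (G := G)
    (fun e t => max (G.pullback w e t) (max (T e t) (T (G.rev e) (1 - t)))) g
    (fun e t ht => by
      simp only [G.rev_rev, sub_sub_cancel]
      rw [pullback_rev w e ht, max_comm (T (G.rev e) t)])
    (fun e => by simpa using hg e)
  have hdom : G.Dominated F u := by
    intro e s t hs hst ht
    rw [hu e t ⟨hs.trans hst, ht⟩, hu e s ⟨hs, hst.trans ht⟩, sub_le_iff_le_add]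
    have h1 := hw.1.1 e s t hs hst ht
    have h2 := (hT e s t hs hst ht).1
    have h3 := (hT (G.rev e) (1 - t) (1 - s) (by linarith) (by linarith) (by linarith)).2
    rw [G.rev_rev, sub_sub_cancel, sub_sub_cancel] at h3
    refine max_le ?_ (max_le ?_ ?_)
    · linarith [le_max_left (G.pullback w e s) (max (T e s) (T (G.rev e) (1 - s)))]
    · linarith [(le_max_left (T e s) (T (G.rev e) (1 - s))).trans (le_max_right (G.pullback w e s) _)]
    · linarith [(le_max_right (T e s) (T (G.rev e) (1 - s))).trans (le_max_right (G.pullback w e s) _)]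
  have huy : u y = α := by
    obtain ⟨e, s, hs, hes⟩ := exists_arc_eq y
    rw [← pullback_eq u hs hes, hu e s hs, ← hw.1.2, ← pullback_eq w hs hes]
    refine max_eq_left (max_le (hy e s hs hes) ?_)
    have := hy (G.rev e) (1 - s) (one_sub_mem hs)
      (by rw [G.arc_rev e _ (one_sub_mem hs), sub_sub_cancel, hes])
    rwa [pullback_rev w e (one_sub_mem hs), sub_sub_cancel] at this
  intro e s hs
  have h := hw.2 ⟨hdom, huy⟩ (G.arcMap e ⟨s, hs⟩)
  rw [← pullback_of_mem u e hs, ← pullback_of_mem w e hs, hu e s hs] at h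
  exact ((le_max_left _ _).trans (le_max_right _ _)).trans h

variable (G) in
/-- The value of `w` at the point `s` of the arc `e` is carried from an earlier point of the arc at
the full rate `F`. -/
def Carried (F : E → ℝ → ℝ) (w : G.support → ℝ) (e : E) (s : ℝ) : Prop :=
  ∃ r, 0 ≤ r ∧ r < s ∧ G.pullback w e s - G.pullback w e r = F e s - F e r

theorem Dominated.lt_of_not_carried {w : G.support → ℝ} (hw : G.Dominated F w) {e : E} {s : ℝ}
    (hs : s ≤ 1) (h : ¬ G.Carried F w e s) {r : ℝ} (hr : 0 ≤ r) (hrs : r < s) :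
    G.pullback w e s - G.pullback w e r < F e s - F e r :=
  lt_of_le_of_ne (hw e r s hr hrs.le hs) fun h' => h ⟨r, hr, hrs, h'⟩

/-- If the point `s` of the arc `e` is not carried, then for small `η` the bound for the increments
from the origin and from `y` holds with the margin `η`. -/
theorem Dominated.eventually_margin {w : G.support → ℝ} (hw : G.Dominated F w) {e : E} {s : ℝ}
    (hs0 : 0 < s) (hs : s ≤ 1) (h : ¬ G.Carried F w e s) (y : EuclideanSpace ℝ (Fin N)) :
    ∀ᶠ η in 𝓝[>] (0 : ℝ), ∀ r, 0 ≤ r → r < s → (r = 0 ∨ G.arc e r = y) →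
      G.pullback w e s - G.pullback w e r + η ≤ F e s - F e r := by
  have hpt : ∀ r, 0 ≤ r → r < s → ∀ᶠ η in 𝓝[>] (0 : ℝ),
      G.pullback w e s - G.pullback w e r + η ≤ F e s - F e r := fun r hr hrs => by
    have := hw.lt_of_not_carried hs h hr hrs
    have h' : (0 : ℝ) < F e s - F e r - (G.pullback w e s - G.pullback w e r) := by linarith
    filter_upwards [Ioo_mem_nhdsGT h'] with η hη
    linarith [hη.2]
  by_cases hex : ∃ r, 0 ≤ r ∧ r < s ∧ G.arc e r = y
  · obtain ⟨q, hq, hqs, hqy⟩ := hex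
    filter_upwards [hpt 0 le_rfl hs0, hpt q hq hqs] with η h0 h1 r hr hrs hry
    rcases hry with rfl | hry
    · exact h0
    -- By simplicity the arc meets `y` at most once in `[0,s)`, so only two strict inequalities need
    -- a common margin.
    · rcases G.simple e r ⟨hr, hrs.le.trans hs⟩ q ⟨hq, hqs.le.trans hs⟩ (hry.trans hqy.symm) with
        rfl | ⟨-, h'⟩ | ⟨h', -⟩
      · exact h1
      · linarith
      · linarith
  · filter_upwards [hpt 0 le_rfl hs0] with η h0 r hr hrs hry
    rcases hry with rfl | hry
    · exact h0
    · exact absurd ⟨r, hr, hrs, hry⟩ hex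

/-- At a vertex other than `y` the maximal dominated function is carried by some arc. -/
theorem exists_carried_of_vertex (hF : G.Reversible F) {y : G.support} {α : ℝ}
    {w : G.support → ℝ} (hw : IsGreatest {u | G.Dominated F u ∧ u y = α} w) {x : G.support}
    (hx : (x : EuclideanSpace ℝ (Fin N)) ∈ G.vertices) (hxy : x ≠ y) :
    ∃ e, G.arc e 1 = x ∧ G.Carried F w e 1 := by
  classical
  by_contra! hcon
  have h0 : (0 : ℝ) ∈ Icc (0 : ℝ) 1 := by simp
  have h1 : (1 : ℝ) ∈ Icc (0 : ℝ) 1 := by simp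
  have hev : ∀ᶠ η in 𝓝[>] (0 : ℝ), ∀ e, G.arc e 1 = x → ∀ r, 0 ≤ r → r < 1 →
      (r = 0 ∨ G.arc e r = y) → G.pullback w e 1 - G.pullback w e r + η ≤ F e 1 - F e r := by
    refine eventually_all.2 fun e => ?_
    by_cases he : G.arc e 1 = x
    · filter_upwards [hw.1.1.eventually_margin one_pos le_rfl (hcon e he) y] with η h _ using h
    · exact Eventually.of_forall fun _ h => absurd h he
  obtain ⟨η, hη, hpos⟩ := (hev.and self_mem_nhdsWithin).exists
  replace hpos : 0 < η := hpos
  have hwx : ∀ e, G.arc e 1 = x → G.pullback w e 1 = w x := fun e he => pullback_eq w h1 he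
  -- Each arc into `x` carries the value `w x + η` backwards at full rate. The margin at `r = 0`
  -- brings it below `w` at the origin, even when the arc is closed, and the margin at `y` keeps the
  -- value there.
  have key := le_of_isGreatest hw
    (fun e t => if G.arc e 1 = x then w x + η - F e 1 + F e t else G.pullback w e t)
    (fun z => if hz : z ∈ G.support then w ⟨z, hz⟩ + (if z = x then η else 0) else 0) ?_ ?_ ?_
  · obtain ⟨e, he⟩ := exists_arc_one_eq hx
    have := key e 1 h1
    simp only [he, if_true, hwx e he] at this
    linarith
  · intro e s t hs hst ht
    by_cases he : G.arc e 1 = x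
    · simp only [he, if_true]
      exact ⟨by linarith, by linarith [hF e s t hs hst ht]⟩
    · simp only [he, if_false]
      exact ⟨hw.1.1 e s t hs hst ht, hw.1.1.rev e hs hst ht⟩
  · intro e
    have hmem : G.arc e 1 ∈ G.support := (G.arcMap e ⟨1, h1⟩).2
    have hw1 : w ⟨G.arc e 1, hmem⟩ = G.pullback w e 1 := (pullback_of_mem w e h1).symm
    have hr0 : G.pullback w (G.rev e) 0 = G.pullback w e 1 := by rw [pullback_rev w e h0, sub_zero]
    simp only [hmem, dif_pos, hw1]
    have hT : G.arc (G.rev e) 1 = x →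
        w x + η - F (G.rev e) 1 + F (G.rev e) 0 ≤ G.pullback w e 1 := fun he => by
      have := hη _ he 0 le_rfl one_pos (Or.inl rfl)
      rw [hwx _ he, hr0] at this
      linarith
    by_cases he : G.arc e 1 = x
    · simp only [he, if_true, hwx e he] at hT ⊢
      rw [max_eq_right, max_eq_left]
      · ring
      · split_ifs with h
        · linarith [hT h]
        · rw [hr0, hwx e he]; linarith
      · exact le_max_of_le_left (by linarith)
    · simp only [he, if_false, add_zero]
      refine max_eq_left (max_le le_rfl ?_)
      split_ifs with h
      · exact hT h
      · exact hr0.le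
  · intro e s hs hes
    split_ifs with he
    · have hs1 : s < 1 := hs.2.lt_of_ne fun h => hxy (Subtype.ext (by rw [← he, ← hes, h]))
      have := hη e he s hs.1 hs1 (Or.inr hes)
      rw [hwx e he] at this
      linarith
    · exact le_rfl

/-- At an interior point of an arc, other than `y`, the maximal dominated function is carried by
the arc or by its inverse. -/
theorem carried_of_interior (hF : G.Reversible F) {y : G.support} {α : ℝ}
    {w : G.support → ℝ} (hw : IsGreatest {u | G.Dominated F u ∧ u y = α} w) {e : E} {s : ℝ}
    (hs : s ∈ Ioo (0 : ℝ) 1) (hy : G.arc e s ≠ y) :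
    G.Carried F w e s ∨ G.Carried F w (G.rev e) (1 - s) := by
  classical
  by_contra! hcon
  have hsI := Ioo_subset_Icc_self hs
  obtain ⟨η, ⟨hη1, hη2⟩, hpos⟩ :=
    (((hw.1.1.eventually_margin hs.1 hs.2.le hcon.1 y).and
      (hw.1.1.eventually_margin (by linarith [hs.2]) (by linarith [hs.1]) hcon.2 y)).and
      self_mem_nhdsWithin).exists
  replace hpos : 0 < η := hpos
  have hrs : G.pullback w (G.rev e) (1 - s) = G.pullback w e s := by
    rw [pullback_rev w e (one_sub_mem hsI), sub_sub_cancel]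
  -- The competitor is a tent with peak `w + η` at `s`, falling at full rate on both sides. It must
  -- not exceed `w` at the ends of the arc or at `y`.
  have hfar : ∀ t ∈ Icc (0 : ℝ) 1, t ≠ s → (t = 0 ∨ t = 1 ∨ G.arc e t = y) →
      G.pullback w e s + η + min (F e t - F e s)
        (F (G.rev e) (1 - t) - F (G.rev e) (1 - s)) ≤ G.pullback w e t := by
    intro t ht hts hor
    rcases hts.lt_or_gt with h | h
    · have := hη1 t ht.1 h (by rcases hor with h' | h' | h' <;> [tauto; linarith [hs.2]; tauto])
      linarith [min_le_left (F e t - F e s) (F (G.rev e) (1 - t) - F (G.rev e) (1 - s))]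
    · have := hη2 (1 - t) (by linarith [ht.2]) (by linarith) (by
        rw [G.arc_rev e _ (one_sub_mem ht), sub_sub_cancel]
        rcases hor with h' | h' | h'
        · linarith [hs.1]
        · left; linarith
        · exact Or.inr h')
      rw [hrs, pullback_rev w e (one_sub_mem ht), sub_sub_cancel] at this
      linarith [min_le_right (F e t - F e s) (F (G.rev e) (1 - t) - F (G.rev e) (1 - s))]
  have key := le_of_isGreatest hw
    (fun f t => if f = e then G.pullback w e s + η + min (F e t - F e s)
        (F (G.rev e) (1 - t) - F (G.rev e) (1 - s)) else G.pullback w f t)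
    (fun z => if hz : z ∈ G.support then w ⟨z, hz⟩ else 0) ?_ ?_ ?_
  · have := key e s hsI
    simp only [if_true, sub_self, min_self] at this
    linarith
  · intro f r t hr hrt ht
    by_cases hf : f = e
    · subst hf
      simp only [if_true]
      have := hF f r t hr hrt ht
      -- The minimum of the two slopes is dominated because each branch is, one of them by
      -- `Reversible`.
      rcases le_total (F f t - F f s) (F (G.rev f) (1 - t) - F (G.rev f) (1 - s)) with h | h <;>
      rcases le_total (F f r - F f s) (F (G.rev f) (1 - r) - F (G.rev f) (1 - s)) with h' | h' <;>
      simp only [h, h', min_eq_left, min_eq_right] <;> constructor <;> linarith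
    · simp only [hf, if_false]
      exact ⟨hw.1.1 f r t hr hrt ht, hw.1.1.rev f hr hrt ht⟩
  · intro f
    have h0 : (0 : ℝ) ∈ Icc (0 : ℝ) 1 := by simp
    have h1 : (1 : ℝ) ∈ Icc (0 : ℝ) 1 := by simp
    have hmem : G.arc f 1 ∈ G.support := (G.arcMap f ⟨1, h1⟩).2
    have hw1 : w ⟨G.arc f 1, hmem⟩ = G.pullback w f 1 := (pullback_of_mem w f h1).symm
    simp only [hmem, dif_pos, hw1]
    refine max_eq_left (max_le ?_ ?_)
    · split_ifs with hf
      · rw [hf]; exact hfar 1 h1 hs.2.ne' (by tauto)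
      · exact le_rfl
    · have hr0 : G.pullback w (G.rev f) 0 = G.pullback w f 1 := by
        rw [pullback_rev w f h0, sub_zero]
      rw [← hr0]
      split_ifs with hf
      · rw [hf]; exact hfar 0 h0 hs.1.ne (by tauto)
      · exact le_rfl
  · intro f t ht hft
    split_ifs with hf
    · subst hf
      exact hfar t ht (fun h => hy (h ▸ hft)) (by tauto)
    · exact le_rfl

end EmbeddedNetwork

/-! ### Viscosity tests and increments on an interval -/

/-- Left difference quotients suffice, so the comparison remains available at the right endpoint `s
= 1`. -/
theorem deriv_le_of_increment_le {f g : ℝ → ℝ} {f' g' r s : ℝ} (hrs : r < s)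
    (hf : HasDerivWithinAt f f' (Ioo r s) s) (hg : HasDerivWithinAt g g' (Ioo r s) s)
    (h : ∀ᶠ t in 𝓝[Ioo r s] s, f s - f t ≤ g s - g t) : f' ≤ g' := by
  have hs : s ∉ Ioo r s := fun h => lt_irrefl _ h.2
  have := right_nhdsWithin_Ioo_neBot hrs
  refine le_of_tendsto_of_tendsto ((hasDerivWithinAt_iff_tendsto_slope' hs).1 hf)
    ((hasDerivWithinAt_iff_tendsto_slope' hs).1 hg) ?_
  filter_upwards [h, self_mem_nhdsWithin] with t ht hts
  rw [slope_def_field, slope_def_field]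
  exact (div_le_div_right_of_neg (sub_neg.2 hts.2)).2 (by linarith)

theorem hasDerivWithinAt_of_contDiffOn {φ : ℝ → ℝ} (hφ : ContDiffOn ℝ 1 φ (Icc 0 1)) {s : ℝ}
    (hs : s ∈ Icc (0 : ℝ) 1) :
    HasDerivWithinAt φ (derivWithin φ (Icc 0 1) s) (Icc 0 1) s :=
  (hφ.differentiableOn one_ne_zero s hs).hasDerivWithinAt

theorem mapsTo_one_sub : MapsTo (fun t : ℝ => 1 - t) (Icc 0 1) (Icc 0 1) :=
  fun _ => EmbeddedNetwork.one_sub_mem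

theorem tendsto_one_sub_nhdsWithin (s : ℝ) :
    Tendsto (fun t : ℝ => 1 - t) (𝓝[Icc 0 1] (1 - s)) (𝓝[Icc 0 1] s) := by
  have := (ContinuousWithinAt.tendsto_nhdsWithin (f := fun t : ℝ => 1 - t) (x := 1 - s)
    (s := Icc (0 : ℝ) 1) (by fun_prop) mapsTo_one_sub)
  simpa using this

theorem derivWithin_comp_one_sub {φ : ℝ → ℝ} (hφ : ContDiffOn ℝ 1 φ (Icc 0 1)) {s : ℝ}
    (hs : s ∈ Icc (0 : ℝ) 1) :
    derivWithin (fun t => φ (1 - t)) (Icc 0 1) (1 - s) = -derivWithin φ (Icc 0 1) s := by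
  have h1 : HasDerivWithinAt (fun t : ℝ => 1 - t) (-1) (Icc 0 1) (1 - s) :=
    ((hasDerivAt_id _).const_sub 1).hasDerivWithinAt
  have h2 : HasDerivWithinAt φ (derivWithin φ (Icc 0 1) s) (Icc 0 1) (1 - (1 - s)) := by
    rw [sub_sub_cancel]; exact hasDerivWithinAt_of_contDiffOn hφ hs
  have h3 := HasDerivWithinAt.scomp (1 - s) h2 h1 mapsTo_one_sub
  rw [show (fun t => φ (1 - t)) = φ ∘ fun t => 1 - t from rfl,
    h3.derivWithin (uniqueDiffOn_Icc one_pos _ (EmbeddedNetwork.one_sub_mem hs))]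
  simp

theorem IsSubtangentAt.comp_one_sub {w w' φ : ℝ → ℝ} {s : ℝ} (h : IsSubtangentAt w φ s)
    (hs : s ∈ Icc (0 : ℝ) 1) (hw : ∀ t ∈ Icc (0 : ℝ) 1, w' t = w (1 - t)) :
    IsSubtangentAt w' (fun t => φ (1 - t)) (1 - s) := by
  refine ⟨h.1.comp (by fun_prop) mapsTo_one_sub, ?_, ?_⟩
  · simpa only [hw _ (EmbeddedNetwork.one_sub_mem hs), sub_sub_cancel] using h.2.1
  · filter_upwards [(tendsto_one_sub_nhdsWithin s).eventually h.2.2, self_mem_nhdsWithin] with t h ht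
    rwa [hw t ht]

theorem IsSupertangentAt.comp_one_sub {w w' φ : ℝ → ℝ} {s : ℝ} (h : IsSupertangentAt w φ s)
    (hs : s ∈ Icc (0 : ℝ) 1) (hw : ∀ t ∈ Icc (0 : ℝ) 1, w' t = w (1 - t)) :
    IsSupertangentAt w' (fun t => φ (1 - t)) (1 - s) := by
  refine ⟨h.1.comp (by fun_prop) mapsTo_one_sub, ?_, ?_⟩
  · simpa only [hw _ (EmbeddedNetwork.one_sub_mem hs), sub_sub_cancel] using h.2.1
  · filter_upwards [(tendsto_one_sub_nhdsWithin s).eventually h.2.2, self_mem_nhdsWithin] with t h ht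
    rwa [hw t ht]

theorem nhdsWithin_Ioo_le {r s : ℝ} (hr : 0 ≤ r) (hs : s ≤ 1) :
    𝓝[Ioo r s] s ≤ 𝓝[Icc (0 : ℝ) 1] s :=
  nhdsWithin_mono _ fun _ ht => ⟨hr.trans ht.1.le, ht.2.le.trans hs⟩

theorem IsSupertangentAt.derivWithin_le {w φ F : ℝ → ℝ} {F' s : ℝ} (h : IsSupertangentAt w φ s)
    (hs0 : 0 < s) (hs : s ≤ 1) (hF : HasDerivAt F F' s)
    (hw : ∀ t, 0 ≤ t → t ≤ s → w s - w t ≤ F s - F t) : derivWithin φ (Icc 0 1) s ≤ F' := by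
  refine deriv_le_of_increment_le hs0
    ((hasDerivWithinAt_of_contDiffOn h.1 ⟨hs0.le, hs⟩).mono fun _ ht => ⟨ht.1.le, ht.2.le.trans hs⟩)
    hF.hasDerivWithinAt ?_
  filter_upwards [nhdsWithin_Ioo_le le_rfl hs h.2.2, self_mem_nhdsWithin] with t h1 ht
  linarith [hw t ht.1.le ht.2.le, h.2.1]

theorem IsSubtangentAt.le_derivWithin {w φ F : ℝ → ℝ} {F' r s : ℝ} (h : IsSubtangentAt w φ s)
    (hr : 0 ≤ r) (hrs : r < s) (hs : s ≤ 1) (hF : HasDerivAt F F' s)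
    (hw : ∀ t, r ≤ t → t ≤ s → F s - F t ≤ w s - w t) : F' ≤ derivWithin φ (Icc 0 1) s := by
  refine deriv_le_of_increment_le hrs hF.hasDerivWithinAt
    ((hasDerivWithinAt_of_contDiffOn h.1 ⟨hr.trans hrs.le, hs⟩).mono
      fun _ ht => ⟨hr.trans ht.1.le, ht.2.le.trans hs⟩) ?_
  filter_upwards [nhdsWithin_Ioo_le hr hs h.2.2, self_mem_nhdsWithin] with t h1 ht
  linarith [hw t ht.1.le ht.2.le, h.2.1]

/-- A viscosity subsolution grows at most as fast as a `C¹` function whose derivative bounds the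
sublevels of the Hamiltonian from above. -/
theorem increment_le_of_viscositySub {h : ℝ → ℝ → ℝ} {a l r : ℝ} {w F F' : ℝ → ℝ} (hl : 0 ≤ l)
    (hr : r ≤ 1) (hw : ContinuousOn w (Icc l r)) (hF : ContDiff ℝ 1 F)
    (hF' : ∀ t, HasDerivAt F (F' t) t) (hsub : ∀ s ∈ Ioo l r, ViscositySubAt h a w s)
    (hh : ∀ s ∈ Ioo l r, ∀ p, F' s < p → a < h s p) {s t : ℝ} (hs : l ≤ s) (hst : s ≤ t)
    (ht : t ≤ r) : w t - w s ≤ F t - F s := by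
  have hg : ContinuousOn (fun t => w t - F t) (Icc l r) := hw.sub hF.continuous.continuousOn
  have main : ∀ t, s < t → t < r → w t - F t ≤ w s - F s := by
    intro t hst htr
    by_contra! hlt
    obtain ⟨t', htt', ht'r⟩ := exists_between htr
    have hst' : 0 < t' - s := by linarith
    -- If `w - F` rises by `d > 0` from `s` to `t`, subtract a `C¹` penalty `ψ` vanishing at `s`.
    -- The steep power makes `ψ` exceed the rise of `w - F` at `t'` while `ψ t < d`, so `w - F - ψ`
    -- has an interior maximum. The linear term makes the slope of `F + ψ` there strictly larger
    -- than `F'`, contradicting the subsolution test.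
    set d := w t - F t - (w s - F s) with hd
    have hdpos : 0 < d := by linarith
    set q := (t - s) / (t' - s) with hq
    have hq0 : 0 ≤ q := div_nonneg (by linarith) hst'.le
    have hq1 : q < 1 := (div_lt_one hst').2 (by linarith)
    set M := |w t' - F t' - (w s - F s)| + 1 with hM
    have hMpos : 0 < M := by positivity
    obtain ⟨m, hm⟩ : ∃ m : ℕ, q ^ m < d / (2 * M) := exists_pow_lt_of_lt_one (by positivity) hq1
    set δ := d / (4 * (t - s)) with hδ
    have hst0 : 0 < t - s := sub_pos.2 hst
    have hδpos : 0 < δ := by positivity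
    set ψ : ℝ → ℝ := fun τ => δ * (τ - s) + M * ((τ - s) / (t' - s)) ^ (m + 1) with hψ
    have hψd : ∀ τ, HasDerivAt ψ
        (δ + M * ((m + 1) * ((τ - s) / (t' - s)) ^ m * (1 / (t' - s)))) τ := by
      intro τ
      have h1 : HasDerivAt (fun τ : ℝ => τ - s) 1 τ := (hasDerivAt_id τ).sub_const s
      have h2 := (((h1.div_const (t' - s)).fun_pow (m + 1)).const_mul M)
      have h3 := (h1.const_mul δ).fun_add h2
      exact h3.congr_deriv (by simp)
    have hψs : ψ s = 0 := by simp [hψ]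
    have hψt' : M ≤ ψ t' := by
      simp only [hψ, div_self hst'.ne', one_pow, mul_one]
      have := mul_pos hδpos hst'
      linarith
    have hψt : ψ t < d := by
      have e1 : δ * (t - s) = d / 4 := by rw [hδ]; field_simp
      have e2 : q ^ (m + 1) ≤ q ^ m := pow_le_pow_of_le_one hq0 hq1.le (Nat.le_succ m)
      have e3 : M * q ^ (m + 1) < d / 2 := by
        calc M * q ^ (m + 1) ≤ M * q ^ m := by gcongr
          _ < M * (d / (2 * M)) := by gcongr
          _ = d / 2 := by field_simp
      simp only [hψ, e1, ← hq]
      linarith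
    have hψc : Continuous ψ := by fun_prop
    obtain ⟨τ, hτ, hmax⟩ := isCompact_Icc.exists_isMaxOn (nonempty_Icc.2 (hst.trans htt').le)
      ((hg.mono (Icc_subset_Icc hs ht'r.le)).sub hψc.continuousOn)
    have hmax' : ∀ x ∈ Icc s t', w x - F x - ψ x ≤ w τ - F τ - ψ τ := fun x hx => hmax hx
    have ht1 := hmax' t ⟨hst.le, htt'.le⟩
    have hτs : s < τ := by
      refine hτ.1.lt_of_ne ?_
      rintro rfl
      rw [hψs] at ht1
      linarith
    have hτt' : τ < t' := by
      refine hτ.2.lt_of_ne ?_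
      rintro rfl
      linarith [le_abs_self (w τ - F τ - (w s - F s))]
    have hτI : τ ∈ Ioo l r := ⟨hs.trans_lt hτs, hτt'.trans ht'r⟩
    have hτ01 : τ ∈ Icc (0 : ℝ) 1 := ⟨hl.trans hτI.1.le, hτI.2.le.trans hr⟩
    have hsup : IsSupertangentAt w (fun x => F x + ψ x + (w τ - F τ - ψ τ)) τ := by
      refine ⟨?_, by ring, ?_⟩
      · have : ContDiff ℝ 1 ψ := by
          have : ContDiff ℝ 1 fun τ : ℝ => (τ - s) / (t' - s) := by fun_prop
          have := this.pow (m + 1)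
          fun_prop
        exact ((hF.add this).add contDiff_const).contDiffOn
      · filter_upwards [mem_nhdsWithin_of_mem_nhds (Ioo_mem_nhds hτs hτt')] with x hx
        linarith [hmax' x (Ioo_subset_Icc_self hx)]
    have hle := hsub τ hτI _ hsup
    rw [((((hF' τ).fun_add (hψd τ)).add_const _).hasDerivWithinAt).derivWithin
      (uniqueDiffOn_Icc one_pos _ hτ01)] at hle
    refine absurd hle (not_le.2 (hh τ hτI _ ?_))
    have : 0 ≤ M * ((m + 1) * ((τ - s) / (t' - s)) ^ m * (1 / (t' - s))) := by
      have : 0 ≤ (τ - s) / (t' - s) := div_nonneg (by linarith) hst'.le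
      positivity
    linarith
  rcases hst.eq_or_lt with rfl | hst
  · simp
  -- The case `t = r` leaves no room for `t'`; it follows by continuity from the left.
  have hlim : w t - F t ≤ w s - F s := by
    have := right_nhdsWithin_Ioo_neBot hst
    refine le_of_tendsto ((hg t ⟨hs.trans hst.le, ht⟩).mono fun x (hx : x ∈ Ioo s t) =>
      ⟨hs.trans hx.1.le, hx.2.le.trans ht⟩) ?_
    filter_upwards [self_mem_nhdsWithin] with x hx
    exact main x hx.1 (hx.2.trans_le ht)
  linarith

/-! ### Geodesic continuity and continuity along arcs -/

namespace EmbeddedNetwork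

variable {N : ℕ} {E : Type*} [Finite E] {G : EmbeddedNetwork N E}

theorem continuous_arcMap (e : E) : Continuous (G.arcMap e) :=
  Continuous.subtype_mk (continuousOn_iff_continuous_domRestrict.1 (G.contDiffOn_arc e).continuousOn) _

/-- A function which is continuous along all arcs is continuous on the network. -/
theorem isContinuous_of_pullback {u : G.support → ℝ}
    (hu : ∀ e, ContinuousOn (G.pullback u e) (Icc 0 1)) : G.IsContinuous u := by
  have hu' : ∀ e, Continuous fun s => u (G.arcMap e s) := fun e => by
    refine (continuousOn_iff_continuous_domRestrict.1 (hu e)).congr fun s => ?_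
    exact pullback_of_mem u e s.2
  -- Preimages of closed sets are finite unions of compact images, so `u` is continuous for the
  -- Euclidean distance, which the geodesic one dominates.
  have hc : Continuous u := by
    refine continuous_iff_isClosed.2 fun C hC => ?_
    have : u ⁻¹' C = ⋃ e, G.arcMap e '' ((fun s => u (G.arcMap e s)) ⁻¹' C) := by
      ext x
      simp only [mem_preimage, mem_iUnion, mem_image]
      constructor
      · intro hx
        obtain ⟨e, s, hs, h⟩ := exists_arc_eq x
        have h' : G.arcMap e ⟨s, hs⟩ = x := Subtype.ext h
        exact ⟨e, ⟨s, hs⟩, by rwa [h'], h'⟩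
      · rintro ⟨e, s, hs, rfl⟩
        exact hs
    rw [this]
    exact isClosed_iUnion_of_finite fun e =>
      ((hC.preimage (hu' e)).isCompact.image (continuous_arcMap e)).isClosed
  intro x ε hε
  obtain ⟨δ, hδ, h⟩ := Metric.continuous_iff.1 hc x ε hε
  refine ⟨ENNReal.ofReal δ, ENNReal.ofReal_pos.2 hδ, fun z hz => ?_⟩
  have hle : edist x z ≤ G.geodesicDist x z := by
    refine le_iInf fun ξ => le_iInf fun hξ => ?_
    have := eVariationOn.edist_le ξ (s := Icc (0 : ℝ) 1) (x := 0) (y := 1) (by simp) (by simp)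
    rwa [hξ.2.2.1, hξ.2.2.2] at this
  have : dist z x < δ := by
    rw [dist_comm, ← ENNReal.ofReal_lt_ofReal_iff hδ, ← edist_dist]
    exact hle.trans_lt hz
  simpa [Real.dist_eq] using h z this

/-- The piece of the arc between the two parameters is an admissible curve, and a `C¹` arc on a
compact interval is Lipschitz. -/
theorem exists_geodesicDist_le (e : E) : ∃ K : NNReal, ∀ s t : Icc (0 : ℝ) 1,
    G.geodesicDist (G.arcMap e s) (G.arcMap e t) ≤ K * edist (s : ℝ) t := by
  obtain ⟨K, hK⟩ := (G.contDiffOn_arc e).exists_lipschitzOnWith one_ne_zero (convex_Icc 0 1)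
    isCompact_Icc
  refine ⟨K, fun s t => ?_⟩
  set g : ℝ → ℝ := fun τ => s + τ * (t - s) with hg
  have hmaps : MapsTo g (Icc 0 1) (Icc 0 1) := by
    intro τ hτ
    have := (convex_Icc (0 : ℝ) 1).add_smul_sub_mem s.2 t.2 hτ
    simpa [hg] using this
  have hlip : LipschitzOnWith (nndist (s : ℝ) t) g univ := by
    refine LipschitzOnWith.of_dist_le_mul fun x _ z _ => ?_
    simp only [hg, coe_nndist, Real.dist_eq]
    rw [← abs_mul, ← abs_neg]
    exact le_of_eq (congrArg _ (by ring))
  have hvar : eVariationOn g (Icc 0 1) ≤ edist (s : ℝ) t := by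
    have h1 := hlip.comp_eVariationOn_le (g := id) (mapsTo_univ id (Icc (0 : ℝ) 1))
    have h2 := (monotone_id.monotoneOn (Icc (0 : ℝ) 1)).eVariationOn_eq (a := 0) (b := 1)
      (by simp) (by simp)
    rw [inter_self] at h2
    rw [h2, id, id, sub_zero, ENNReal.ofReal_one, mul_one] at h1
    rw [edist_nndist]
    exact h1
  refine (iInf₂_le (G.arc e ∘ g) ⟨?_, ?_, ?_, ?_⟩).trans
    ((hK.comp_eVariationOn_le hmaps).trans (by gcongr))
  · exact (G.contDiffOn_arc e).continuousOn.comp (by fun_prop) hmaps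
  · exact fun τ hτ => (G.arcMap e ⟨g τ, hmaps hτ⟩).2
  · simp [hg, arcMap]
  · simp [hg, arcMap]

theorem IsContinuous.continuousOn_pullback {u : G.support → ℝ} (hu : G.IsContinuous u) (e : E) :
    ContinuousOn (G.pullback u e) (Icc 0 1) := by
  obtain ⟨K, hK⟩ := exists_geodesicDist_le (G := G) e
  intro s hs
  refine Metric.tendsto_nhds.2 fun ε hε => ?_
  obtain ⟨δ, hδ, h⟩ := hu (G.arcMap e ⟨s, hs⟩) ε hε
  have hlim : Tendsto (fun t : ℝ => K * edist s t) (𝓝[Icc 0 1] s) (𝓝 0) := by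
    have h1 : Continuous fun t : ℝ => edist s t := by fun_prop
    have := ENNReal.Tendsto.const_mul (a := (K : ℝ≥0∞)) (h1.tendsto s) (Or.inr ENNReal.coe_ne_top)
    simp only [edist_self, mul_zero] at this
    exact this.mono_left nhdsWithin_le_nhds
  filter_upwards [hlim.eventually (eventually_lt_nhds hδ), self_mem_nhdsWithin] with t h1 ht
  rw [pullback_of_mem u e ht, pullback_of_mem u e hs, Real.dist_eq]
  exact h _ ((hK ⟨s, hs⟩ ⟨t, ht⟩).trans_lt h1)

/-- Domination along an arc and its inverse bounds increments from both sides by those of continuous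
functions. -/
theorem Dominated.isContinuous {F : E → ℝ → ℝ} {u : G.support → ℝ} (hu : G.Dominated F u)
    (hF : ∀ e, Continuous (F e)) : G.IsContinuous u := by
  refine isContinuous_of_pullback fun e s hs => ?_
  have key : ∀ t ∈ Icc (0 : ℝ) 1, |G.pullback u e t - G.pullback u e s| ≤
      |F e t - F e s| + |F (G.rev e) (1 - t) - F (G.rev e) (1 - s)| := by
    intro t ht
    rcases le_total s t with h | h
    · have h1 := hu e s t hs.1 h ht.2
      have h2 := hu.rev e hs.1 h ht.2
      rw [abs_le]
      constructor <;>
      linarith [le_abs_self (F e t - F e s), neg_abs_le (F (G.rev e) (1 - t) - F (G.rev e) (1 - s)),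
        abs_nonneg (F e t - F e s), abs_nonneg (F (G.rev e) (1 - t) - F (G.rev e) (1 - s))]
    · have h1 := hu e t s ht.1 h hs.2
      have h2 := hu.rev e ht.1 h hs.2
      rw [abs_le]
      constructor <;>
      linarith [neg_abs_le (F e t - F e s), le_abs_self (F (G.rev e) (1 - t) - F (G.rev e) (1 - s)),
        abs_nonneg (F e t - F e s), abs_nonneg (F (G.rev e) (1 - t) - F (G.rev e) (1 - s))]
  refine tendsto_iff_norm_sub_tendsto_zero.2 (squeeze_zero' (Eventually.of_forall fun _ => norm_nonneg _)
    (g := fun t => |F e t - F e s| + |F (G.rev e) (1 - t) - F (G.rev e) (1 - s)|) ?_ ?_)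
  · filter_upwards [self_mem_nhdsWithin] with t ht using key t ht
  · have h1 := hF e
    have h2 := hF (G.rev e)
    have : Continuous fun t => |F e t - F e s| + |F (G.rev e) (1 - t) - F (G.rev e) (1 - s)| := by
      fun_prop
    have := this.tendsto s
    simp only [sub_self, abs_zero, add_zero] at this
    exact this.mono_left nhdsWithin_le_nhds

end EmbeddedNetwork

/-! ### Sub- and supersolutions through domination -/

namespace NetworkHamiltonian

variable {N : ℕ} {E : Type*} [Finite E] {G : EmbeddedNetwork N E} {H : NetworkHamiltonian G} {a : ℝ}

/-- Subsolutions are the functions whose increments along the arcs are bounded by the integrals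
of `σ_a⁺`. -/
theorem isSubsolution_iff_dominated (ha : H.Admissible a) (u : G.support → ℝ) :
    H.IsSubsolution a u ↔ G.Dominated (fun e => H.sigmaPrim e a) u := by
  constructor
  · rintro ⟨hc, hsub⟩ e s t hs hst ht
    refine increment_le_of_viscositySub le_rfl le_rfl (hc.continuousOn_pullback e)
      (contDiff_sigmaPrim ha) (hasDerivAt_sigmaPrim ha) (hsub e) (fun r hr p hp => ?_) hs hst ht
    have hr' := Ioo_subset_Icc_self hr
    rw [sigmaExt_of_mem hr'] at hp
    exact lt_ham_of_sigmaPlus_lt hr' (ha e r hr') hp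
  · intro hu
    refine ⟨hu.isContinuous fun e => (contDiff_sigmaPrim ha).continuous, fun e s hs φ hφ => ?_⟩
    have hs' := Ioo_subset_Icc_self hs
    have hs'' := EmbeddedNetwork.one_sub_mem hs'
    have h1 := hφ.derivWithin_le hs.1 hs.2.le (hasDerivAt_sigmaPrim (e := e) ha s)
      fun t ht hts => hu e t s ht hts hs.2.le
    have h2 := (hφ.comp_one_sub hs' fun t ht => EmbeddedNetwork.pullback_rev u e ht).derivWithin_le
      (by linarith [hs.2]) hs''.2 (hasDerivAt_sigmaPrim (e := G.rev e) ha (1 - s))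
      fun t ht hts => hu (G.rev e) t (1 - s) ht hts hs''.2
    rw [derivWithin_comp_one_sub hφ.1 hs', sigmaExt_of_mem hs''] at h2
    rw [sigmaExt_of_mem hs'] at h1
    -- The slope of the supertangent lies between two points at level `a`; quasiconvexity concludes.
    have := ham_le_max (H := H) (e := e) hs' (neg_le.1 h2) h1
    rwa [ham_neg_sigmaPlus_rev ha hs', (isGreatest_sigmaPlus hs' (ha e s hs')).1, max_self] at this

/-- Saturation from `r` to `s` and domination from `r` to `t` give increments of `u` from `t` to `s`
at least those of `F`, for every `t` in `[r,s]`. -/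
theorem viscositySuperAt_of_carried (ha : H.Admissible a) {u : G.support → ℝ}
    (hu : G.Dominated (fun e => H.sigmaPrim e a) u) {e : E} {s : ℝ} (hs : s ≤ 1)
    (h : G.Carried (fun e => H.sigmaPrim e a) u e s) :
    ViscositySuperAt (H.ham e) a (G.pullback u e) s := by
  obtain ⟨r, hr, hrs, heq⟩ := h
  intro φ hφ
  have hs' : s ∈ Icc (0 : ℝ) 1 := ⟨hr.trans hrs.le, hs⟩
  refine le_ham_of_sigmaPlus_le hs' (ha e s hs') ?_
  rw [← sigmaExt_of_mem hs']
  refine hφ.le_derivWithin hr hrs hs (hasDerivAt_sigmaPrim ha s) fun t hrt hts => ?_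
  have := hu e r t hr hrt (hts.trans hs)
  simp only at this heq
  linarith

theorem viscositySuperAt_of_rev {u : G.support → ℝ} {e : E} {s : ℝ} (hs : s ∈ Icc (0 : ℝ) 1)
    (h : ViscositySuperAt (H.ham (G.rev e)) a (G.pullback u (G.rev e)) (1 - s)) :
    ViscositySuperAt (H.ham e) a (G.pullback u e) s := by
  intro φ hφ
  have := h _ (hφ.comp_one_sub hs fun t ht => EmbeddedNetwork.pullback_rev u e ht)
  rwa [derivWithin_comp_one_sub hφ.1 hs, H.ham_rev e _ (EmbeddedNetwork.one_sub_mem hs),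
    sub_sub_cancel, neg_neg] at this

end NetworkHamiltonian

/-! ### Admissibility of the levels above `a₀` -/

namespace NetworkHamiltonian

variable {N : ℕ} {E : Type*} [Finite E] {G : EmbeddedNetwork N E} {H : NetworkHamiltonian G} {a : ℝ}

theorem exists_ham_min (e : E) {s : ℝ} (hs : s ∈ Icc (0 : ℝ) 1) :
    ∃ p, ∀ q, H.ham e s p ≤ H.ham e s q :=
  (continuous_ham hs).exists_forall_le (H.coercive e s hs)

theorem iInf_ham_le (e : E) {s : ℝ} (hs : s ∈ Icc (0 : ℝ) 1) (p : ℝ) :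
    ⨅ p, H.ham e s p ≤ H.ham e s p := by
  obtain ⟨q, hq⟩ := exists_ham_min (H := H) e hs
  exact ciInf_le ⟨_, forall_mem_range.2 hq⟩ p

theorem exists_ham_zero_le (e : E) : ∃ B, ∀ s ∈ Icc (0 : ℝ) 1, H.ham e s 0 ≤ B := by
  obtain ⟨B, hB⟩ := isCompact_Icc.bddAbove_image (continuousOn_ham_left (H := H) (e := e) 0)
  exact ⟨B, fun s hs => hB (mem_image_of_mem _ hs)⟩

theorem iInf_ham_le_arcValue (e : E) {s : ℝ} (hs : s ∈ Icc (0 : ℝ) 1) :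
    ⨅ p, H.ham e s p ≤ H.arcValue e := by
  obtain ⟨B, hB⟩ := exists_ham_zero_le (H := H) e
  exact le_ciSup (f := fun s : Icc (0 : ℝ) 1 => ⨅ p, H.ham e s p)
    ⟨B, forall_mem_range.2 fun s => (iInf_ham_le e s.2 0).trans (hB s s.2)⟩ ⟨s, hs⟩

/-- Emptiness of the sublevel `{H_γ(s,·) ≤ a}` is an open condition on `s`. -/
theorem eventually_sublevel_empty {e : E} {s₀ : ℝ} (hs₀ : s₀ ∈ Icc (0 : ℝ) 1)
    (h : ∀ p, a < H.ham e s₀ p) : ∀ᶠ s in 𝓝[Icc 0 1] s₀, ∀ p, a < H.ham e s p := by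
  obtain ⟨p₀, hp₀⟩ := exists_ham_min (H := H) e hs₀
  have hco := (H.coercive e s₀ hs₀).eventually (eventually_gt_atTop (H.ham e s₀ p₀ + 1))
  rw [cocompact_eq_atBot_atTop, eventually_sup] at hco
  -- Coercivity is only pointwise in `s`. Barriers `p₁ < p₀ < p₂` and quasiconvexity make it locally
  -- uniform: outside `[p₁,p₂]` the values stay high for nearby `s`, and inside compactness applies.
  obtain ⟨p₁, hp₁, hp₁'⟩ := (hco.1.and (eventually_lt_atBot p₀)).exists
  obtain ⟨p₂, hp₂, hp₂'⟩ := (hco.2.and (eventually_gt_atTop p₀)).exists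
  have hc := fun p => continuousOn_ham_left (H := H) (e := e) p s₀ hs₀
  have hcont : Continuous fun q : ℝ × ℝ => H.ham e (projIcc 0 1 zero_le_one q.1) q.2 :=
    (H.continuousOn_ham e).comp_continuous
      (f := fun q : ℝ × ℝ => ((projIcc 0 1 zero_le_one q.1 : ℝ), q.2)) (by fun_prop)
      fun q => ⟨(projIcc 0 1 zero_le_one q.1).2, mem_univ _⟩
  have htube : ∀ᶠ s in 𝓝 s₀, ∀ p ∈ Icc p₁ p₂, a < H.ham e (projIcc 0 1 zero_le_one s) p := by
    refine (isCompact_Icc (a := p₁) (b := p₂)).eventually_forall_of_forall_eventually fun p _ => ?_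
    refine (hcont.tendsto (s₀, p)).eventually (eventually_gt_nhds ?_)
    simpa [projIcc_of_mem _ hs₀] using h p
  have hlt : a < H.ham e s₀ p₀ + 1 := by linarith [h p₀]
  filter_upwards [self_mem_nhdsWithin, mem_nhdsWithin_of_mem_nhds htube,
    (hc p₀).eventually (eventually_lt_nhds (lt_add_one _)),
    (hc p₁).eventually (eventually_gt_nhds hp₁),
    (hc p₂).eventually (eventually_gt_nhds hp₂)] with s hs ht h0 h1 h2 p
  rw [projIcc_of_mem _ hs] at ht
  by_cases hp1 : p < p₁
  · have := ham_le_max (H := H) (e := e) hs hp1.le hp₁'.le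
    rcases le_max_iff.1 this with h' | h' <;> linarith
  by_cases hp2 : p₂ < p
  · have := ham_le_max (H := H) (e := e) hs hp₂'.le hp2.le
    rcases le_max_iff.1 this with h' | h' <;> linarith
  exact ht p ⟨not_lt.1 hp1, not_lt.1 hp2⟩

/-- An empty sublevel stays empty on an interval, where the subsolution test would force `w` to
decrease faster than any linear function. -/
theorem IsPeriodicSubsolution.exists_ham_le {e : E} {w : ℝ → ℝ}
    (hw : H.IsPeriodicSubsolution e a w) {s : ℝ} (hs : s ∈ Icc (0 : ℝ) 1) :
    ∃ p, H.ham e s p ≤ a := by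
  by_contra! h
  obtain ⟨ε, hε, hball⟩ := Metric.mem_nhdsWithin_iff.1 (eventually_sublevel_empty hs h)
  obtain ⟨l, r, hl, hr, hlr, hsub⟩ : ∃ l r : ℝ, 0 ≤ l ∧ r ≤ 1 ∧ l < r ∧
      ∀ t ∈ Ioo l r, t ∈ Metric.ball s ε := by
    refine ⟨max 0 (s - ε / 2), min 1 (s + ε / 2), le_max_left _ _, min_le_left _ _, ?_, ?_⟩
    · refine max_lt (lt_min one_pos (by linarith [hs.1])) (lt_min (by linarith [hs.2]) (by linarith))
    · intro t ht
      rw [Real.ball_eq_Ioo]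
      exact ⟨by linarith [(le_max_right _ _).trans_lt ht.1],
        by linarith [ht.2.trans_le (min_le_right _ _)]⟩
  have hsub' : ∀ t ∈ Ioo l r, ∀ p, a < H.ham e t p := fun t ht =>
    hball ⟨hsub t ht, hl.trans ht.1.le, ht.2.le.trans hr⟩
  -- A slope `-K` steep enough that the forced decrease over `[l,r]` exceeds `|w r - w l|`.
  set K := (|w r - w l| + 1) / (r - l) with hK
  have hrl : 0 < r - l := sub_pos.2 hlr
  have := increment_le_of_viscositySub (F := fun t => -K * t) (F' := fun _ => -K) hl hr
    (hw.1.mono (Icc_subset_Icc hl hr)) (by fun_prop)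
    (fun t => by simpa using (hasDerivAt_id t).const_mul (-K))
    (fun t ht => hw.2.2 t ⟨hl.trans_lt ht.1, ht.2.trans_le hr⟩)
    (fun t ht p _ => hsub' t ht p) le_rfl hlr.le le_rfl
  have hKe : K * (r - l) = |w r - w l| + 1 := by rw [hK]; field_simp
  have h2 := neg_abs_le (w r - w l)
  linarith

theorem exists_isPeriodicSubsolution (e : E) : ∃ b, ∃ w, H.IsPeriodicSubsolution e b w := by
  obtain ⟨B, hB⟩ := exists_ham_zero_le (H := H) e
  refine ⟨B, fun _ => 0, continuousOn_const, rfl, fun s hs φ hφ => ?_⟩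
  have hmem : Icc (0 : ℝ) 1 ∈ 𝓝 s := Icc_mem_nhds hs.1 hs.2
  have hmin : IsLocalMin φ s := by
    have := hφ.2.2
    rw [nhdsWithin_eq_nhds.2 hmem] at this
    filter_upwards [this] with t ht
    rw [hφ.2.1]; exact ht
  rw [derivWithin_of_mem_nhds hmem, hmin.deriv_eq_zero]
  exact hB s (Ioo_subset_Icc_self hs)

theorem arcValue_le_periodicValue (e : E) : H.arcValue e ≤ H.periodicValue e := by
  refine le_csInf (exists_isPeriodicSubsolution e) ?_
  rintro b ⟨w, hw⟩
  refine ciSup_le fun s => ?_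
  obtain ⟨p, hp⟩ := hw.exists_ham_le s.2
  exact (iInf_ham_le e s.2 p).trans hp

theorem arcValue_le_baseValue (e : E) : H.arcValue e ≤ H.baseValue := by
  classical
  refine le_trans ?_ (le_ciSup (f := fun e => if G.IsClosedArc e then H.periodicValue e
    else H.arcValue e) (Set.finite_range _).bddAbove e)
  split_ifs
  · exact arcValue_le_periodicValue e
  · exact le_rfl

theorem admissible_of_baseValue_le (ha : H.baseValue ≤ a) : H.Admissible a := by
  intro e s hs
  obtain ⟨p, hp⟩ := exists_ham_min (H := H) e hs
  exact ⟨p, (le_ciInf hp).trans ((iInf_ham_le_arcValue e hs).trans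
    ((arcValue_le_baseValue e).trans ha))⟩

/-! ### Existence of dominated functions for every `a ≥ c` -/

theorem sigmaExt_mono (ha : H.Admissible a) {b : ℝ} (hab : a ≤ b) (e : E) (t : ℝ) :
    H.sigmaExt e a t ≤ H.sigmaExt e b t :=
  sigmaPlus_mono (projIcc 0 1 zero_le_one t).2 (ha e _ (projIcc 0 1 zero_le_one t).2) hab

theorem sigmaPrim_sub (ha : H.Admissible a) (e : E) (s t : ℝ) :
    H.sigmaPrim e a t - H.sigmaPrim e a s = ∫ r in s..t, H.sigmaExt e a r :=
  intervalIntegral.integral_interval_sub_left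
    ((continuous_sigmaExt ha).intervalIntegrable _ _)
    ((continuous_sigmaExt ha).intervalIntegrable _ _)

theorem _root_.EmbeddedNetwork.Dominated.sigmaPrim_mono {u : G.support → ℝ}
    (hu : G.Dominated (fun e => H.sigmaPrim e a) u) (ha : H.Admissible a) {b : ℝ} (hab : a ≤ b) :
    G.Dominated (fun e => H.sigmaPrim e b) u := by
  intro e s t hs hst ht
  refine (hu e s t hs hst ht).trans ?_
  simp only [sigmaPrim_sub ha, sigmaPrim_sub (ha.mono hab)]
  exact intervalIntegral.integral_mono_on hst ((continuous_sigmaExt ha).intervalIntegrable _ _)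
    ((continuous_sigmaExt (ha.mono hab)).intervalIntegrable _ _) fun r _ => sigmaExt_mono ha hab e r

/-- `a ↦ ∫₀ᵗ σ_a⁺` is continuous from the right. -/
theorem tendsto_sigmaPrim (ha : H.Admissible a) {b : ℕ → ℝ} (hb : ∀ n, a ≤ b n)
    (hlim : Tendsto b atTop (𝓝 a)) (e : E) (t : ℝ) :
    Tendsto (fun n => H.sigmaPrim e (b n) t) atTop (𝓝 (H.sigmaPrim e a t)) := by
  have hev : ∀ᶠ n in atTop, b n ≤ a + 1 := hlim.eventually_le_const (lt_add_one a)
  refine intervalIntegral.tendsto_integral_filter_of_dominated_convergence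
    (fun r => |H.sigmaExt e a r| + |H.sigmaExt e (a + 1) r|) ?_ ?_ ?_ ?_
  · exact Eventually.of_forall fun n =>
      (continuous_sigmaExt (ha.mono (hb n))).aestronglyMeasurable
  · filter_upwards [hev] with n hn
    refine Eventually.of_forall fun r _ => ?_
    have h1 := sigmaExt_mono ha (hb n) e r
    have h2 := sigmaExt_mono (ha.mono (hb n)) hn e r
    rw [Real.norm_eq_abs, abs_le]
    constructor <;> linarith [neg_abs_le (H.sigmaExt e a r), le_abs_self (H.sigmaExt e (a + 1) r),
      abs_nonneg (H.sigmaExt e a r), abs_nonneg (H.sigmaExt e (a + 1) r)]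
  · exact ((continuous_sigmaExt ha).abs.add
      (continuous_sigmaExt (ha.mono (lt_add_one a).le)).abs).intervalIntegrable _ _
  · refine Eventually.of_forall fun r _ => ?_
    refine tendsto_order.2 ⟨fun q hq => ?_, fun q hq => ?_⟩
    · exact Eventually.of_forall fun n => hq.trans_le (sigmaExt_mono ha (hb n) e r)
    -- If `σ_a⁺ < q ≤ σ_b⁺`, quasiconvexity gives `H(q) ≤ b`, which fails for `b` close to `a`
    -- because `H(q) > a`.
    · set r' := projIcc (0 : ℝ) 1 zero_le_one r
      have := lt_ham_of_sigmaPlus_lt r'.2 (ha e r' r'.2) hq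
      filter_upwards [hlim.eventually (eventually_lt_nhds this)] with n hn
      by_contra! hle
      have hmax := ham_le_max (H := H) (e := e) r'.2 hq.le hle
      change H.ham e r' q ≤ max (H.ham e r' (H.sigmaPlus e a r'))
        (H.ham e r' (H.sigmaPlus e (b n) r')) at hmax
      rw [(isGreatest_sigmaPlus r'.2 (ha e r' r'.2)).1,
        (isGreatest_sigmaPlus r'.2 (ha.mono (hb n) e r' r'.2)).1, max_eq_right (hb n)] at hmax
      linarith

/-- A subsolution of the discrete functional equation extends to a subsolution on the network. -/
theorem IsDiscreteSubsolution.exists_dominated (ha : H.Admissible a) {g : G.vertices → ℝ}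
    (hg : H.IsDiscreteSubsolution a g) : ∃ u, G.Dominated (fun e => H.sigmaPrim e a) u := by
  classical
  have hrev : ∀ e, G.origin (G.rev e) = G.terminus e := fun e =>
    Subtype.ext (EmbeddedNetwork.arc_rev_zero e)
  have hrev' : ∀ e, G.terminus (G.rev e) = G.origin e := fun e =>
    Subtype.ext (EmbeddedNetwork.arc_rev_one e)
  -- A point of an arc takes the cheaper of the values carried from the two ends; the discrete
  -- inequality says precisely that this restores `g` at the vertices.
  obtain ⟨u, hu⟩ := EmbeddedNetwork.exists_pullback_eq (G := G)
    (fun e t => min (g (G.origin e) + H.sigmaPrim e a t)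
      (g (G.terminus e) + H.sigmaPrim (G.rev e) a (1 - t)))
    (fun x => if hx : x ∈ G.vertices then g ⟨x, hx⟩ else 0)
    (fun e t ht => by simp only [hrev, hrev', G.rev_rev, sub_sub_cancel, min_comm])
    (fun e => by
      have hmem : G.arc e 1 ∈ G.vertices := ⟨e, Or.inr rfl⟩
      have := hg _ (G.rev e) rfl
      rw [hrev, hrev', G.rev_rev] at this
      simp only [hmem, dif_pos, sigmaPrim_one, sub_self, sigmaPrim_zero, add_zero]
      exact min_eq_right this)
  refine ⟨u, fun e s t hs hst ht => ?_⟩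
  rw [hu e t ⟨hs.trans hst, ht⟩, hu e s ⟨hs, hst.trans ht⟩, sub_le_iff_le_add, ← sub_le_iff_le_add']
  refine le_min ?_ ?_
  · linarith [min_le_left (g (G.origin e) + H.sigmaPrim e a t)
      (g (G.terminus e) + H.sigmaPrim (G.rev e) a (1 - t))]
  · linarith [min_le_right (g (G.origin e) + H.sigmaPrim e a t)
      (g (G.terminus e) + H.sigmaPrim (G.rev e) a (1 - t)), sigmaPrim_reversible ha e hs hst ht]

/-- At a level above all values `H_γ(s,0)` one has `σ ≥ 0`, so constants qualify. Thus the infimum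
defining `c` is over a nonempty set. -/
theorem exists_isDiscreteSubsolution :
    ∃ a, H.baseValue ≤ a ∧ ∃ u, H.IsDiscreteSubsolution a u := by
  choose B hB using exists_ham_zero_le (H := H)
  obtain ⟨C, hC⟩ := (Set.finite_range B).bddAbove
  refine ⟨max C H.baseValue, le_max_right _ _, fun _ => 0, fun x e _ => ?_⟩
  have hnn : 0 ≤ H.sigma (max C H.baseValue) (G.rev e) := by
    refine intervalIntegral.integral_nonneg zero_le_one fun t ht => ?_
    have : H.ham (G.rev e) t 0 ≤ max C H.baseValue :=
      (hB _ t ht).trans ((hC (mem_range_self _)).trans (le_max_left _ _))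
    exact (isGreatest_sigmaPlus ht ⟨0, this⟩).2 0 this
  linarith

theorem baseValue_le_criticalValue : H.baseValue ≤ H.criticalValue :=
  le_csInf exists_isDiscreteSubsolution fun _ h => h.1

theorem exists_dominated_of_criticalValue_lt (ha : H.criticalValue < a) :
    ∃ u, G.Dominated (fun e => H.sigmaPrim e a) u := by
  obtain ⟨b, ⟨hb, g, hg⟩, hba⟩ := exists_lt_of_csInf_lt exists_isDiscreteSubsolution ha
  have hb' := admissible_of_baseValue_le hb
  obtain ⟨u, hu⟩ := hg.exists_dominated hb'
  exact ⟨u, hu.sigmaPrim_mono hb' hba.le⟩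

/-- Subsolutions exist at all levels from the critical value on, the critical one included. -/
theorem exists_dominated (ha : H.criticalValue ≤ a) (y : G.support) :
    ∃ u, G.Dominated (fun e => H.sigmaPrim e a) u := by
  have hadm : H.Admissible a := admissible_of_baseValue_le (baseValue_le_criticalValue.trans ha)
  -- The infimum defining `c` is not known to be attained, so the level `a` is approached from
  -- strictly above.
  set b : ℕ → ℝ := fun n => a + 1 / ((n : ℝ) + 1) with hb
  have hpos : ∀ n : ℕ, 0 < 1 / ((n : ℝ) + 1) := fun n => by positivity
  have hab : ∀ n, a ≤ b n := fun n => by linarith [hpos n]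
  have hb1 : ∀ n, b n ≤ a + 1 := fun n => by
    have : 1 / ((n : ℝ) + 1) ≤ 1 := by
      rw [div_le_one (by positivity)]; linarith [n.cast_nonneg (α := ℝ)]
    linarith
  have hlim : Tendsto b atTop (𝓝 a) := by
    simpa [hb] using (tendsto_one_div_add_atTop_nhds_zero_nat (𝕜 := ℝ)).const_add a
  have hex : ∀ n, ∃ u, G.Dominated (fun e => H.sigmaPrim e (b n)) u ∧ u y = 0 := fun n => by
    obtain ⟨u, hu⟩ := exists_dominated_of_criticalValue_lt (H := H) (a := b n)
      (by linarith [hpos n])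
    exact ⟨_, hu.add_const (-u y), by simp⟩
  choose v hv hvy using hex
  -- Normalised at `y` and dominated at level `a + 1`, the functions are pointwise bounded; a single
  -- ultrafilter gives limits at all points at once, with no extraction of subsequences.
  have hbdd : ∀ x, ∃ l, Tendsto (fun n => v n x) (hyperfilter ℕ) (𝓝 l) := by
    intro x
    obtain ⟨C, hC⟩ := EmbeddedNetwork.exists_bound (G := G) (fun e => H.sigmaPrim e (a + 1)) y x
    obtain ⟨C', hC'⟩ := EmbeddedNetwork.exists_bound (G := G) (fun e => H.sigmaPrim e (a + 1)) x y
    have hmem : ∀ n, v n x ∈ Icc (-C') C := fun n => by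
      have hd := (hv n).sigmaPrim_mono (hadm.mono (hab n)) (hb1 n)
      have h1 := hC _ hd
      have h2 := hC' _ hd
      rw [hvy n] at h1 h2
      exact ⟨by linarith, by linarith⟩
    obtain ⟨l, -, hl⟩ := isCompact_Icc.ultrafilter_le_nhds
      ((hyperfilter ℕ).map fun n => v n x)
      (le_principal_iff.2 (Filter.mem_map.2 (Eventually.of_forall hmem)))
    exact ⟨l, hl⟩
  choose u hu using hbdd
  have hle : (hyperfilter ℕ : Filter ℕ) ≤ atTop := Nat.hyperfilter_le_atTop
  refine ⟨u, fun e s t hs hst ht => ?_⟩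
  have h1 : ∀ r (hr : r ∈ Icc (0 : ℝ) 1),
      Tendsto (fun n => G.pullback (v n) e r) (hyperfilter ℕ) (𝓝 (G.pullback u e r)) := by
    intro r hr
    simp only [EmbeddedNetwork.pullback_of_mem _ e hr]
    exact hu _
  refine le_of_tendsto_of_tendsto ((h1 t ⟨hs.trans hst, ht⟩).sub (h1 s ⟨hs, hst.trans ht⟩))
    (((tendsto_sigmaPrim hadm hab hlim e t).sub (tendsto_sigmaPrim hadm hab hlim e s)).mono_left
      hle) (Eventually.of_forall fun n => hv n e s t hs hst ht)

end NetworkHamiltonian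

open NetworkHamiltonian in
/-- For `a ≥ c`, `y ∈ Γ` and any real `α`, the maximal subsolution of `H(x,Du) = a` with value `α`
at `y` exists and is a solution in `Γ \ {y}`. -/
theorem theorem6p1 {N : ℕ} {E : Type*} [Finite E] (G : EmbeddedNetwork N E)
    (H : NetworkHamiltonian G) (hH : H.MinConstantAtBase)
    (a : ℝ) (ha : H.criticalValue ≤ a) (y : G.support) (α : ℝ) :
    ∃ w : G.support → ℝ,
      IsGreatest {u : G.support → ℝ | H.IsSubsolution a u ∧ u y = α} w ∧
      H.IsSolutionOn a {y}ᶜ w := by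
  have hadm : H.Admissible a := admissible_of_baseValue_le (baseValue_le_criticalValue.trans ha)
  have hrev : G.Reversible fun e => H.sigmaPrim e a := fun e _ _ => sigmaPrim_reversible hadm e
  obtain ⟨u₀, hu₀⟩ := exists_dominated ha y
  obtain ⟨w, hw⟩ := EmbeddedNetwork.exists_isGreatest_dominated hu₀ y α
  have hsub := (isSubsolution_iff_dominated hadm w).2 hw.1.1
  refine ⟨w, by simpa only [isSubsolution_iff_dominated hadm] using hw, hsub.1, ?_, ?_⟩
  · intro e s hs hy
    refine ⟨hsub.2 e s hs, ?_⟩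
    rcases EmbeddedNetwork.carried_of_interior hrev hw hs fun h => hy (Subtype.ext h) with h | h
    · exact viscositySuperAt_of_carried hadm hw.1.1 hs.2.le h
    · exact viscositySuperAt_of_rev s.2
        (viscositySuperAt_of_carried hadm hw.1.1 (by linarith [hs.1]) h)
  · intro x hx hxv
    obtain ⟨e, he, h⟩ := EmbeddedNetwork.exists_carried_of_vertex hrev hw hxv hx
    exact ⟨e, he, viscositySuperAt_of_carried hadm hw.1.1 le_rfl h⟩
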